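/- A cover of a simple graph $G$ is a pair $(L,H)$ of a graph $H$ and a map $L$ assigning to each $u\in V(G)$ a set $L(u)\subseteq V(H)$ such that: the sets $L(u)$ partition $V(H)$; each $H[L(u)]$ is complete; for $u\ne v$, there are edges of $H$ between $L(u)$ and $L(v)$ only if $uv\in E(G)$, and in that case they form a (possibly empty, not necessarily perfect) matching. It is $2$-fold if $|L(u)|=2$ for all $u$; the two elements of $L(u)$ are then named, in an arbitrary way, $p(u)$ (poor) and $r(u)$ (rich). For integers $0\le i\le j$, an $(i,j)$-defective coloring of such a cover is an injection $\phi:V(G)\to V(H)$ with $\phi(u)\in L(u)$ for all $u$ such that, in the subgraph of $H$ induced by $\phi(V(G))$, every poor vertex has degree at most $i$ and every rich vertex has degree at most $j$. The graph $G$ is $(i,j)$-defective-DP-colorable if every $2$-fold cover of $G$, with every choice of poor and rich vertices, has an $(i,j)$-defective coloring; $G$ is $(i,j)$-defective-DP-critical if it is not $(i,j)$-defective-DP-colorable but every proper subgraph of $G$ is. Let $g_{DP}(i,j,n)$ be the minimum number of edges in an $n$-vertex $(i,j)$-defective-DP-critical simple graph (with $g_{DP}(i,j,n)=\infty$ if there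 is none). **Theorem.** Let $i\ge 3$ and $j\ge 2i+1$ be integers. Every (finite) $n$-vertex $(i,j)$-defective-DP-critical simple graph has at least $$\frac{(2i+1)n+j-i+1}{i+1}$$ edges; hence $g_{DP}(i,j,n)\ge \frac{(2i+1)n+j-i+1}{i+1}$ for every $n$. This is sharp: for each such pair $(i,j)$, equality $g_{DP}(i,j,n)=\frac{(2i+1)n+j-i+1}{i+1}$ holds for infinitely many $n$. -/

import Mathlib

universe u

namespace DefectiveDP

/-- A cover `(L, H)` of a simple graph `G`, where `W` is the vertex set of the cover graph `H`.
The lists `L u` partition `W` (non-emptiness of the parts is implied for the `2`-fold covers used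
below), each list is a clique of `H`, and edges of `H` between different lists lie over edges of
`G` and form a matching over each edge of `G`. -/
structure Cover {V : Type u} (G : SimpleGraph V) (W : Type u) where
  L : V → Set W
  H : SimpleGraph W
  pairwise_disjoint : ∀ u v, u ≠ v → Disjoint (L u) (L v)
  iUnion_eq : ⋃ u, L u = Set.univ
  isClique : ∀ u, H.IsClique (L u)
  adj_of_adj : ∀ u v, ∀ a ∈ L u, ∀ b ∈ L v, H.Adj a b → u = v ∨ G.Adj u v
  /-- Every vertex of `L u` has at most one neighbour in `L v`; as `u` and `v` may be exchanged,
  the edges of `H` between `L u` and `L v` form a (possibly empty) matching. -/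
  matching : ∀ u v, G.Adj u v → ∀ a ∈ L u, ∀ b ∈ L v, ∀ b' ∈ L v,
    H.Adj a b → H.Adj a b' → b = b'

namespace Cover

variable {V W : Type u} {G : SimpleGraph V}

/-- All lists have exactly `k` elements. -/
def IsFold (C : Cover G W) (k : ℕ) : Prop :=
  ∀ u, (C.L u).ncard = k

/-- An `(L, H)`-map: an injection choosing one element of each list. -/
def IsMap (C : Cover G W) (φ : V → W) : Prop :=
  Function.Injective φ ∧ ∀ v, φ v ∈ C.L v

/-- The degree of `φ v` in the subgraph `H_φ` of `H` induced by the image of `φ`. -/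
noncomputable def inducedDegree (C : Cover G W) (φ : V → W) (v : V) : ℕ :=
  (C.H.neighborSet (φ v) ∩ Set.range φ).ncard

/-- `φ` is an `(i, j)`-defective colouring with respect to the cover `C`, where `p u` is the poor
and `r u` the rich element of `L u`. -/
def IsDefectiveColoring (C : Cover G W) (p r : V → W) (i j : ℕ) (φ : V → W) : Prop :=
  C.IsMap φ ∧ ∀ v, (φ v = p v → C.inducedDegree φ v ≤ i) ∧ (φ v = r v → C.inducedDegree φ v ≤ j)

end Cover

/-- `G` is `(i, j)`-defective-DP-colourable: for every `2`-fold cover and every naming of the two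
elements of each list as poor and rich there is an `(i, j)`-defective colouring. -/
def IsColorable {V : Type u} (G : SimpleGraph V) (i j : ℕ) : Prop :=
  ∀ (W : Type u) (C : Cover G W), C.IsFold 2 →
    ∀ p r : V → W, (∀ u, C.L u = {p u, r u}) → ∃ φ, C.IsDefectiveColoring p r i j φ

/-- `G` is `(i, j)`-defective-DP-critical: it is not colourable, but every proper subgraph is. -/
def IsCritical {V : Type u} (G : SimpleGraph V) (i j : ℕ) : Prop :=
  ¬ IsColorable G i j ∧ ∀ G' : G.Subgraph, G' ≠ ⊤ → IsColorable G'.coe i j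

/-- The minimum number of edges of an `n`-vertex `(i, j)`-defective-DP-critical simple graph;
it is `⊤` if there is no such graph. -/
noncomputable def gDP (i j n : ℕ) : ℕ∞ :=
  ⨅ (G : SimpleGraph (Fin n)) (_ : IsCritical G i j), (G.edgeSet.ncard : ℕ∞)

/-- The bound `((2i+1)n + j - i + 1) / (i+1)`, as a real number. -/
noncomputable def edgeBound (i j n : ℕ) : ℝ :=
  ((2 * (i : ℝ) + 1) * n + j - i + 1) / (i + 1)

end DefectiveDP

/-! A cover of a graph matters only through the signs of its edges: over each edge the matching may
be taken to be perfect, so it either joins equal colours or different ones, and a colouring is a map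
to `Bool` in which every edge is a conflict or not. The argument allows arbitrary capacities at the
vertices (at most `i` for poor and `j` for rich) and gives a vertex with capacities `a` and `b` the
potential `a + b + 1 + i - j`, which is `2 * i + 1` for full capacities; an edge costs `i + 1`.

**Lower bound.** The main result is `exists_respectsOn`: if every nonempty set of vertices has
potential at least `i - j`, then a colouring respecting the capacities exists. In a critical graph,
a nonempty set of minimum potential is the whole vertex set, since otherwise it could be coloured
and the colouring extended, so its potential is less than `i - j`. This is the claimed bound.

Extensions of colourings come from fractional orientations. By Hall's theorem (`exists_units`), if
no set outside a coloured set `S` lowers the potential, every edge outside `S` can give `i + 1` units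
to its ends such that a vertex receives at most its potential, minus `i + 1` for each
neighbour in `S`. As this is less than `2 * (i + 1)`, every vertex receives all units of at most one
of its edges; the other end of that edge is its parent. Vertices can avoid conflicts with their
parents, except once on each cycle, where the conflict can be placed between two rich vertices
(`exists_parent_coloring`). The other edges at a vertex give it at least one unit each, so their
number is at most the poor capacity if there is a parent, and at most the rich capacity
otherwise: here `2 * i + 1 ≤ j` is used. This is `exists_extension`.

In a minimal counterexample to `exists_respectsOn`, deleting an edge and lowering the capacities of
both ends by one is allowed by `3 ≤ i`, unless a set of potential at most `i - j + 1` contains exactly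
one end of the edge. For a largest such set, `exists_extension` with one exceptional vertex yields
a contradiction unless the other end of the edge has degree two and full capacities
(`degree_eq_two_of_low`). So every edge has an end of degree two. A vertex of degree two can always
avoid a conflict with one chosen neighbour, so it acts as an edge that loads only one of its ends;
such graphs are coloured by `exists_virtual_coloring`.

**Sharpness.** Tight weighted graphs (`IsTight`) are built from a single vertex with capacities `-1`
and `-1`. Attaching a flag (`attach`) to `v` makes up for increasing a capacity of `v` by one, and
leaves the potential unchanged. If the new neighbour of `v` gets poor capacity `i - 1`, the next
flag can be attached to it, so there are arbitrarily large tight graphs with full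
capacities. By `exists_respectsOn` these are critical. -/

namespace DefectiveDP

open Finset

/-! ### Neighbours and edges inside a set of vertices -/

section Counting

variable {V : Type*}

open Classical in
/-- The neighbours of `v` that lie in `S`. -/
noncomputable def nbrsOn (G : SimpleGraph V) (S : Finset V) (v : V) : Finset V :=
  {w ∈ S | G.Adj v w}

open Classical in
/-- The edges of `G` with both ends in `S`. -/
noncomputable def edgesOn (G : SimpleGraph V) (S : Finset V) : Finset (Sym2 V) :=
  {e ∈ S.sym2 | e ∈ G.edgeSet}

@[simp] lemma mem_nbrsOn {G : SimpleGraph V} {S : Finset V} {v w : V} :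
    w ∈ nbrsOn G S v ↔ w ∈ S ∧ G.Adj v w := by
  simp [nbrsOn]

lemma mem_edgesOn {G : SimpleGraph V} {S : Finset V} {e : Sym2 V} :
    e ∈ edgesOn G S ↔ (∀ a ∈ e, a ∈ S) ∧ e ∈ G.edgeSet := by
  simp [edgesOn]

@[simp] lemma mk_mem_edgesOn {G : SimpleGraph V} {S : Finset V} {u v : V} :
    s(u, v) ∈ edgesOn G S ↔ (u ∈ S ∧ v ∈ S) ∧ G.Adj u v := by
  simp [edgesOn]

@[simp] lemma edgesOn_empty (G : SimpleGraph V) : edgesOn G ∅ = ∅ := by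
  simp [edgesOn]

lemma edgesOn_mono (G : SimpleGraph V) {S T : Finset V} (h : S ⊆ T) :
    edgesOn G S ⊆ edgesOn G T := by
  intro e he
  rw [mem_edgesOn] at he ⊢
  exact ⟨fun a ha => h (he.1 a ha), he.2⟩

lemma disjoint_nbrsOn (G : SimpleGraph V) {S T : Finset V} (h : Disjoint S T) (v : V) :
    Disjoint (nbrsOn G S v) (nbrsOn G T v) :=
  Finset.disjoint_left.2 fun _ hw hw' =>
    Finset.disjoint_left.1 h (mem_nbrsOn.1 hw).1 (mem_nbrsOn.1 hw').1

variable [DecidableEq V]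

lemma sum_edgesOn_insert {M : Type*} [AddCommMonoid M] (G : SimpleGraph V) {S : Finset V} {v : V}
    (hv : v ∉ S) (m : Sym2 V → M) :
    ∑ e ∈ edgesOn G (insert v S), m e
      = ∑ e ∈ edgesOn G S, m e + ∑ w ∈ nbrsOn G S v, m s(v, w) := by
  have himg : ∑ w ∈ nbrsOn G S v, m s(v, w)
      = ∑ e ∈ (nbrsOn G S v).image (fun w => s(v, w)), m e := by
    rw [sum_image]
    intro a _ b _ hab
    exact Sym2.congr_right.1 hab
  have hdisj : Disjoint (edgesOn G S) ((nbrsOn G S v).image (fun w => s(v, w))) := by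
    rw [Finset.disjoint_left]
    intro e he he'
    obtain ⟨w, -, rfl⟩ := mem_image.1 he'
    exact hv (mk_mem_edgesOn.1 he).1.1
  rw [himg, ← sum_union hdisj]
  congr 1
  ext e
  induction e with
  | _ a b =>
    simp only [mk_mem_edgesOn, mem_union, mem_image, mem_nbrsOn, mem_insert, Sym2.eq_iff]
    constructor
    · rintro ⟨⟨rfl | ha, rfl | hb⟩, hab⟩
      · exact absurd hab (G.irrefl)
      · exact Or.inr ⟨b, ⟨hb, hab⟩, Or.inl ⟨rfl, rfl⟩⟩
      · exact Or.inr ⟨a, ⟨ha, hab.symm⟩, Or.inr ⟨rfl, rfl⟩⟩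
      · exact Or.inl ⟨⟨ha, hb⟩, hab⟩
    · rintro (⟨⟨ha, hb⟩, hab⟩ | ⟨w, ⟨hw, hvw⟩, ⟨rfl, rfl⟩ | ⟨rfl, rfl⟩⟩)
      · exact ⟨⟨Or.inr ha, Or.inr hb⟩, hab⟩
      · exact ⟨⟨Or.inl rfl, Or.inr hw⟩, hvw⟩
      · exact ⟨⟨Or.inr hw, Or.inl rfl⟩, hvw.symm⟩

lemma card_edgesOn_insert (G : SimpleGraph V) {S : Finset V} {v : V} (hv : v ∉ S) :
    #(edgesOn G (insert v S)) = #(edgesOn G S) + #(nbrsOn G S v) := by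
  simp only [card_eq_sum_ones]
  exact sum_edgesOn_insert G hv (fun _ => 1)

lemma nbrsOn_union (G : SimpleGraph V) (S T : Finset V) (v : V) :
    nbrsOn G (S ∪ T) v = nbrsOn G S v ∪ nbrsOn G T v := by
  ext w
  simp [or_and_right]

lemma card_edgesOn_union (G : SimpleGraph V) {S T : Finset V} (h : Disjoint S T) :
    #(edgesOn G (S ∪ T)) = #(edgesOn G S) + #(edgesOn G T) + ∑ t ∈ T, #(nbrsOn G S t) := by
  induction T using Finset.induction_on with
  | empty => simp
  | insert t T ht ih =>
    rw [disjoint_insert_right] at h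
    have ht' : t ∉ S ∪ T := by simp [ht, h.1]
    rw [union_insert, card_edgesOn_insert G ht', ih h.2, card_edgesOn_insert G ht, sum_insert ht,
      nbrsOn_union, card_union_of_disjoint (disjoint_nbrsOn G h.2 t)]
    omega

end Counting

/-! ### Potentials -/

section Potential

variable {V : Type*}

/-- The potential of a vertex with capacities `c v false` (poor) and `c v true` (rich). It equals
`2 * i + 1` for the full capacities `i` and `j`. -/
def vertexPotential (i j : ℕ) (c : V → Bool → ℤ) (v : V) : ℤ :=
  c v false + c v true + 1 + i - j

/-- The potential of a set of vertices: the sum of the potentials of its vertices, minus `i + 1`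
for each edge it induces. -/
noncomputable def potential (i j : ℕ) (G : SimpleGraph V) (c : V → Bool → ℤ) (S : Finset V) : ℤ :=
  ∑ v ∈ S, vertexPotential i j c v - (i + 1) * #(edgesOn G S)

variable {i j : ℕ} {G : SimpleGraph V} {c : V → Bool → ℤ} {S T : Finset V} {v : V}

@[simp] lemma potential_empty : potential i j G c ∅ = 0 := by simp [potential]

variable [DecidableEq V]

lemma potential_insert (hv : v ∉ S) :
    potential i j G c (insert v S)
      = potential i j G c S + vertexPotential i j c v - (i + 1) * #(nbrsOn G S v) := by
  simp only [potential, sum_insert hv, card_edgesOn_insert G hv]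
  push_cast
  ring

lemma potential_union (h : Disjoint S T) :
    potential i j G c (S ∪ T)
      = potential i j G c S + potential i j G c T - (i + 1) * ∑ t ∈ T, (#(nbrsOn G S t) : ℤ) := by
  simp only [potential, sum_union h, card_edgesOn_union G h]
  push_cast
  ring

end Potential

/-! ### Orientations with bounded indegrees -/

section Orientation

variable {V : Type*} [DecidableEq V]

/-- A form of Hakimi's orientation theorem, deduced from Hall's marriage theorem: the edges of a
multigraph can each be assigned to one of their ends, within the budgets `b` of the vertices,
as soon as every set of vertices induces at most as many edges as its total budget. -/
lemma exists_orientation {ε : Type*} [DecidableEq ε] (E : Finset ε) (s t : ε → V) (D : Finset V)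
    (b : V → ℤ) (hE : ∀ e ∈ E, s e ∈ D ∧ t e ∈ D)
    (h : ∀ T ⊆ D, (#{e ∈ E | s e ∈ T ∧ t e ∈ T} : ℤ) ≤ ∑ v ∈ T, b v) :
    ∃ o : ε → V, (∀ e ∈ E, o e = s e ∨ o e = t e) ∧ ∀ v ∈ D, (#{e ∈ E | o e = v} : ℤ) ≤ b v := by
  have hb : ∀ v ∈ D, 0 ≤ b v := by
    intro v hv
    have := h {v} (by simpa using hv)
    simp only [sum_singleton] at this
    omega
  let slots : ε → Finset (Σ _ : V, ℕ) := fun e =>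
    ({s e, t e} : Finset V).sigma (fun v => range (b v).toNat)
  have hall : ∀ J : Finset E, #J ≤ #(J.biUnion fun e => slots e.1) := by
    intro J
    let T : Finset V := J.biUnion fun e => {s e.1, t e.1}
    have hTD : T ⊆ D := by
      intro v hv
      simp only [T, mem_biUnion, mem_insert, mem_singleton] at hv
      obtain ⟨e, -, rfl | rfl⟩ := hv
      · exact (hE e.1 e.2).1
      · exact (hE e.1 e.2).2
    have h1 : #J ≤ #{e ∈ E | s e ∈ T ∧ t e ∈ T} := by
      rw [← card_map (Function.Embedding.subtype _)]
      refine card_le_card ?_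
      intro e he
      obtain ⟨e', he', rfl⟩ := mem_map.1 he
      simp only [mem_filter, T, mem_biUnion, mem_insert, mem_singleton,
        Function.Embedding.coe_subtype]
      exact ⟨e'.2, ⟨e', he', Or.inl rfl⟩, ⟨e', he', Or.inr rfl⟩⟩
    have h2 : (J.biUnion fun e => slots e.1) = T.sigma (fun v => range (b v).toNat) := by
      ext ⟨v, l⟩
      simp only [slots, T, mem_biUnion, mem_sigma, mem_insert, mem_singleton]
      constructor
      · rintro ⟨e, he, hv, hl⟩
        exact ⟨⟨e, he, hv⟩, hl⟩
      · rintro ⟨⟨e, he, hv⟩, hl⟩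
        exact ⟨e, he, hv, hl⟩
    rw [h2, card_sigma]
    simp only [card_range]
    have h3 : ((∑ v ∈ T, (b v).toNat : ℕ) : ℤ) = ∑ v ∈ T, b v := by
      push_cast
      exact sum_congr rfl fun v hv => by have := hb v (hTD hv); omega
    have := h T hTD
    omega
  obtain ⟨g, hg, hgs⟩ :=
    (Finset.all_card_le_biUnion_card_iff_exists_injective fun e : E => slots e.1).1 hall
  refine ⟨fun e => if he : e ∈ E then (g ⟨e, he⟩).1 else s e, ?_, ?_⟩
  · intro e he
    have := hgs ⟨e, he⟩
    simp only [slots, mem_sigma, mem_insert, mem_singleton] at this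
    simpa [he] using this.1
  · intro v hv
    have : #{e ∈ E | (if he : e ∈ E then (g ⟨e, he⟩).1 else s e) = v} ≤ #(range (b v).toNat) := by
      refine card_le_card_of_injOn (fun e => if he : e ∈ E then (g ⟨e, he⟩).2 else 0) ?_ ?_
      · intro e he
        simp only [coe_filter, Set.mem_ofPred_eq] at he
        obtain ⟨he, hv⟩ := he
        simp only [he, dite_true] at hv ⊢
        have := hgs ⟨e, he⟩
        simp only [slots, mem_sigma] at this
        rw [← hv]
        exact_mod_cast this.2
      · intro e he e' he' hee
        simp only [coe_filter, Set.mem_ofPred_eq] at he he'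
        obtain ⟨he, hv⟩ := he
        obtain ⟨he', hv'⟩ := he'
        simp only [he, he', dite_true] at hv hv' hee
        have : g ⟨e, he⟩ = g ⟨e', he'⟩ :=
          Sigma.ext (hv.trans hv'.symm) (heq_of_eq hee)
        simpa using hg this
    have h' := hb v hv
    rw [card_range] at this
    beta_reduce
    omega

/-- Every edge `s(u, v)` of `G[D]` can distribute `m s(u, v)` units among its ends, `f u v` of them
to `v`, so that no vertex receives more than its budget, as soon as Hall's condition holds. -/
lemma exists_units (G : SimpleGraph V) (D : Finset V) (m : Sym2 V → ℕ) (b : V → ℤ)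
    (h : ∀ T ⊆ D, ((∑ e ∈ edgesOn G T, m e : ℕ) : ℤ) ≤ ∑ v ∈ T, b v) :
    ∃ f : V → V → ℕ, (∀ u ∈ D, ∀ v ∈ D, G.Adj u v → f u v + f v u = m s(u, v)) ∧
      ∀ v ∈ D, ((∑ u ∈ nbrsOn G D v, f u v : ℕ) : ℤ) ≤ b v := by
  classical
  let E : Finset (Σ _ : Sym2 V, ℕ) := (edgesOn G D).sigma fun e => range (m e)
  have hout : ∀ e : Sym2 V, s((Quot.out e).1, (Quot.out e).2) = e := fun e => Quot.out_eq e
  obtain ⟨o, ho, hob⟩ := exists_orientation E (fun x => (Quot.out x.1).1)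
    (fun x => (Quot.out x.1).2) D b (by
      rintro ⟨e, l⟩ he
      simp only [E, mem_sigma] at he
      have := he.1
      rw [← hout e, mk_mem_edgesOn] at this
      exact this.1) (by
      intro T hT
      refine le_trans ?_ (h T hT)
      have : #{x ∈ E | (Quot.out x.1).1 ∈ T ∧ (Quot.out x.1).2 ∈ T}
          ≤ #((edgesOn G T).sigma fun e => range (m e)) := by
        refine card_le_card ?_
        rintro ⟨e, l⟩ he
        simp only [E, mem_filter, mem_sigma] at he ⊢
        refine ⟨?_, he.1.2⟩
        have h1 := he.1.1
        rw [← hout e, mk_mem_edgesOn] at h1 ⊢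
        exact ⟨he.2, h1.2⟩
      rw [card_sigma] at this
      simp only [card_range] at this
      exact_mod_cast this)
  refine ⟨fun u v => #{l ∈ range (m s(u, v)) | o ⟨s(u, v), l⟩ = v}, ?_, ?_⟩
  · intro u hu v hv huv
    have key : ∀ l ∈ range (m s(u, v)), o ⟨s(u, v), l⟩ = u ↔ ¬ o ⟨s(u, v), l⟩ = v := by
      intro l hl
      have h1 := ho ⟨s(u, v), l⟩ (by
        simp only [E, mem_sigma, mk_mem_edgesOn]
        exact ⟨⟨⟨hu, hv⟩, huv⟩, hl⟩)
      have h2 := hout s(u, v)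
      rw [Sym2.eq_iff] at h2
      have hne := huv.ne
      simp only at h1
      rcases h2 with ⟨ha, hb⟩ | ⟨ha, hb⟩ <;> rw [ha, hb] at h1 <;> rcases h1 with h1 | h1 <;>
        rw [h1] <;> simp [hne, hne.symm]
    have hs : s(v, u) = s(u, v) := Sym2.eq_swap
    simp only [hs]
    rw [filter_congr key, add_comm]
    have := card_filter_add_card_filter_not (s := range (m s(u, v))) (fun l => o ⟨s(u, v), l⟩ = v)
    rw [card_range] at this
    omega
  · intro v hv
    refine le_trans ?_ (hob v hv)
    rw [← card_sigma]
    norm_cast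
    refine card_le_card_of_injOn (fun x => ⟨s(x.1, v), x.2⟩) ?_ ?_
    · rintro ⟨u, l⟩ hx
      simp only [coe_sigma, Set.mem_sigma_iff, mem_coe, mem_nbrsOn, mem_filter] at hx
      simp only [coe_filter, Set.mem_ofPred_eq, E, mem_sigma, mk_mem_edgesOn]
      exact ⟨⟨⟨⟨hx.1.1, hv⟩, hx.1.2.symm⟩, hx.2.1⟩, hx.2.2⟩
    · rintro ⟨u, l⟩ - ⟨u', l'⟩ - hx
      simp only [Sigma.mk.injEq, heq_eq_eq] at hx
      obtain ⟨h1, h2⟩ := hx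
      rw [Sym2.congr_left] at h1
      simp [h1, h2]

end Orientation

/-! ### Extending colourings -/

section Extension

variable {V : Type*}

open Classical in
/-- Colour classes are encoded by `φ : V → Bool` (`false` for poor, `true` for rich) and the
matchings of a cover by signs `K` on the edges: the edge `s(v, w)` is a conflict of `φ` when
`φ v ^^ φ w = K s(v, w)`. This is the set of vertices of `S` in conflict with `v`. -/
noncomputable def conflictsOn (G : SimpleGraph V) (K : Sym2 V → Bool) (φ : V → Bool)
    (S : Finset V) (v : V) : Finset V :=
  {w ∈ S | G.Adj v w ∧ (φ v ^^ φ w) = K s(v, w)}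

@[simp] lemma mem_conflictsOn {G : SimpleGraph V} {K : Sym2 V → Bool} {φ : V → Bool}
    {S : Finset V} {v w : V} :
    w ∈ conflictsOn G K φ S v ↔ w ∈ S ∧ G.Adj v w ∧ (φ v ^^ φ w) = K s(v, w) := by
  simp [conflictsOn]

/-- `φ` respects the capacities `c` on the subgraph induced by `S`. -/
def RespectsOn (G : SimpleGraph V) (K : Sym2 V → Bool) (c : V → Bool → ℤ) (S : Finset V)
    (φ : V → Bool) : Prop :=
  ∀ v ∈ S, (#(conflictsOn G K φ S v) : ℤ) ≤ c v (φ v)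

variable [DecidableEq V]

/-- Each vertex of `D` has at most one parent in `D`. There is a colouring with prescribed colours
at the vertices without parent, in which no vertex conflicts with its parent, except that on each
cycle of the parent map one conflict may be needed; that conflict is between two rich vertices. -/
lemma exists_parent_coloring (K : Sym2 V → Bool) (D : Finset V) (par : V → Option V)
    (τ : V → Bool) (h : ∀ v ∈ D, ∀ u, par v = some u → u ∈ D ∧ u ≠ v) :
    ∃ φ : V → Bool, (∀ v ∈ D, par v = none → φ v = τ v) ∧
      ∀ v ∈ D, ∀ u, par v = some u → (φ v ^^ φ u) = K s(v, u) →
        φ v = true ∧ φ u = true ∧ par u ≠ none ∧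
          ∀ v' ∈ D, par v' = some u → (φ v' ^^ φ u) = K s(v', u) → v' = v := by
  induction hn : #D + #{v ∈ D | par v ≠ none} using Nat.strong_induction_on
    generalizing D par τ with
  | _ n ih =>
  by_cases hleaf : ∃ v ∈ D, ∀ v' ∈ D, par v' ≠ some v
  · -- a vertex without children can be coloured last
    obtain ⟨v, hv, hch⟩ := hleaf
    have hlt : #(D.erase v) + #{w ∈ D.erase v | par w ≠ none} < n := by
      rw [← hn]
      have h1 := card_erase_lt_of_mem hv
      have h2 : #{w ∈ D.erase v | par w ≠ none} ≤ #{w ∈ D | par w ≠ none} :=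
        card_le_card (filter_subset_filter _ (erase_subset _ _))
      omega
    obtain ⟨φ, hφ1, hφ2⟩ := ih _ hlt (D.erase v) par τ (by
      intro w hw u hu
      have hw' := mem_of_mem_erase hw
      refine ⟨mem_erase.2 ⟨?_, (h w hw' u hu).1⟩, (h w hw' u hu).2⟩
      rintro rfl
      exact hch w hw' hu) rfl
    let x : Bool := match par v with
      | none => τ v
      | some u => φ u ^^ !K s(v, u)
    have hvavoid : ∀ u, par v = some u → (x ^^ φ u) ≠ K s(v, u) := by
      intro u hu
      simp only [x, hu]
      cases φ u <;> cases K s(v, u) <;> simp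
    refine ⟨Function.update φ v x, ?_, ?_⟩
    · intro w hw hpw
      by_cases hwv : w = v
      · subst hwv
        simp [x, hpw]
      · rw [Function.update_of_ne hwv]
        exact hφ1 w (mem_erase.2 ⟨hwv, hw⟩) hpw
    · intro w hw u hu hconf
      have huv : u ≠ v := by
        rintro rfl
        exact hch w hw hu
      rw [Function.update_of_ne huv] at hconf ⊢
      by_cases hwv : w = v
      · subst hwv
        rw [Function.update_self] at hconf
        exact absurd hconf (hvavoid u hu)
      · rw [Function.update_of_ne hwv] at hconf ⊢
        obtain ⟨h1, h2, h3, h4⟩ := hφ2 w (mem_erase.2 ⟨hwv, hw⟩) u hu hconf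
        refine ⟨h1, h2, h3, ?_⟩
        intro v' hv' hpv' hc
        by_cases hv'v : v' = v
        · subst hv'v
          rw [Function.update_self] at hc
          exact absurd hc (hvavoid u hpv')
        · rw [Function.update_of_ne hv'v] at hc
          exact h4 v' (mem_erase.2 ⟨hv'v, hv'⟩) hpv' hc
  · -- otherwise the parent map permutes `D`
    push Not at hleaf
    choose! ch hchD hch using hleaf
    have hinj : Set.InjOn ch D := by
      intro a ha b hb hab
      have := hch a ha
      rw [hab, hch b hb] at this
      exact (Option.some.inj this).symm
    have hsurj : Set.SurjOn ch D D :=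
      Finset.surjOn_of_injOn_of_card_le ch (fun a ha => hchD a ha) hinj le_rfl
    have hpar : ∀ w ∈ D, ∃ u ∈ D, ch u = w ∧ par w = some u := by
      intro w hw
      obtain ⟨u, hu, rfl⟩ := hsurj hw
      exact ⟨u, hu, rfl, hch u hu⟩
    have hparinj : ∀ w ∈ D, ∀ w' ∈ D, ∀ u, par w = some u → par w' = some u → w = w' := by
      intro w hw w' hw' u hu hu'
      obtain ⟨a, -, ha, hpa⟩ := hpar w hw
      obtain ⟨b, -, hb, hpb⟩ := hpar w' hw'
      rw [hu] at hpa
      rw [hu'] at hpb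
      rw [← ha, ← hb, ← Option.some.inj hpa, ← Option.some.inj hpb]
    have hne : ∀ w ∈ D, par w ≠ none := by
      intro w hw
      obtain ⟨u, -, -, hu⟩ := hpar w hw
      simp [hu]
    by_cases hK : ∀ v ∈ D, ∀ u, par v = some u → K s(v, u) = true
    · refine ⟨fun _ => true, fun v hv hp => absurd hp (hne v hv), ?_⟩
      intro v hv u hu hc
      rw [hK v hv u hu] at hc
      simp at hc
    · push Not at hK
      obtain ⟨v, hv, u, hu, hKvu⟩ := hK
      rw [ne_eq, Bool.not_eq_true] at hKvu
      have hlt : #D + #{w ∈ D | Function.update par v none w ≠ none} < n := by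
        rw [← hn]
        refine Nat.add_lt_add_left (card_lt_card ?_) _
        refine ⟨?_, ?_⟩
        · intro w hw
          rw [mem_filter] at hw ⊢
          exact ⟨hw.1, hne w hw.1⟩
        · intro hsub
          have := hsub (mem_filter.2 ⟨hv, hne v hv⟩)
          simp at this
      obtain ⟨φ, hφ1, hφ2⟩ := ih _ hlt D (Function.update par v none) (Function.update τ v true) (by
        intro w hw x hx
        by_cases hwv : w = v
        · subst hwv
          simp at hx
        · rw [Function.update_of_ne hwv] at hx
          exact h w hw x hx) rfl
      have hφv : φ v = true := by
        rw [hφ1 v hv (by simp)]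
        simp
      refine ⟨φ, fun v hv hp => absurd hp (hne v hv), ?_⟩
      intro w hw x hx hc
      have hxD := (h w hw x hx).1
      by_cases hwv : w = v
      · subst hwv
        rw [hu] at hx
        obtain rfl := Option.some.inj hx
        rw [hKvu, hφv] at hc
        refine ⟨hφv, by simpa using hc, hne _ hxD, ?_⟩
        intro v' hv' hp' _
        exact hparinj v' hv' w hw u hp' hu
      · obtain ⟨h1, h2, h3, -⟩ := hφ2 w hw x (by rwa [Function.update_of_ne hwv]) hc
        exact ⟨h1, h2, hne x hxD, fun v' hv' hp' _ => hparinj v' hv' w hw x hp' hx⟩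

variable {i j : ℕ} {G : SimpleGraph V} {K : Sym2 V → Bool} {c : V → Bool → ℤ}

/-- A colouring `φ₀` of `S` extends to a disjoint set `D` if the edges inside `D` can distribute
`i + 1` units each among their ends so that every vertex of `D` has enough potential to pay for the
units it receives and for `i + 1` units per neighbour in `S`. The exceptional vertices in `R`
may exceed their budget by one, but have a single neighbour in `S` and no parent in `D`; they are
coloured rich, and only they may conflict with `S`. An edge giving all its units to one end makes the other end its parent; the numbers of
the remaining edges are bounded by the units received. -/
lemma exists_extension (hi : 1 ≤ i) (hj : 2 * i + 1 ≤ j) (hc : ∀ v, c v false ≤ i ∧ c v true ≤ j)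
    {S D R : Finset V} (hSD : Disjoint S D) (φ₀ : V → Bool) (f : V → V → ℕ)
    (hf : ∀ y ∈ D, ∀ z ∈ D, G.Adj y z → f y z + f z y = i + 1)
    (hD : ∀ y ∈ D, y ∉ R → ((i + 1) * (#(nbrsOn G S y) : ℤ) + ((∑ z ∈ nbrsOn G D y, f z y : ℕ) : ℤ))
      ≤ vertexPotential i j c y)
    (hR : ∀ y ∈ R, #(nbrsOn G S y) = 1 ∧ (∀ z ∈ nbrsOn G D y, f z y ≤ i) ∧
      ((i : ℤ) + 1 + ((∑ z ∈ nbrsOn G D y, f z y : ℕ) : ℤ)) ≤ vertexPotential i j c y + 1) :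
    ∃ φ : V → Bool, (∀ v ∈ S, φ v = φ₀ v) ∧
      (∀ y ∈ D, (#(conflictsOn G K φ (S ∪ D) y) : ℤ) ≤ c y (φ y)) ∧
      ∀ s ∈ S, ∀ y ∈ D, G.Adj y s → (φ y ^^ φ s) = K s(y, s) → y ∈ R ∧ φ y = true := by
  classical
  -- `P y` consists of the parents of `y`, and `F y` of the neighbours with which `y` shares units
  let P : V → Finset V := fun y => {z ∈ nbrsOn G D y | f y z = 0}
  let F : V → Finset V := fun y => {z ∈ nbrsOn G D y | f y z ≠ 0 ∧ f z y ≠ 0}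
  have hunits : ∀ y ∈ D, (#(F y) + (i + 1) * #(P y) : ℤ) ≤ ((∑ z ∈ nbrsOn G D y, f z y : ℕ) : ℤ) := by
    intro y hy
    have hdisj : Disjoint (F y) (P y) := by
      rw [Finset.disjoint_left]
      intro z hz hz'
      exact (mem_filter.1 hz).2.1 (mem_filter.1 hz').2
    have h1 : #(F y) ≤ ∑ z ∈ F y, f z y := by
      rw [card_eq_sum_ones]
      exact sum_le_sum fun z hz => Nat.one_le_iff_ne_zero.2 (mem_filter.1 hz).2.2
    have h2 : (i + 1) * #(P y) = ∑ z ∈ P y, f z y := by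
      rw [mul_comm, ← smul_eq_mul, ← sum_const]
      refine sum_congr rfl fun z hz => ?_
      obtain ⟨hz, hz0⟩ := mem_filter.1 hz
      rw [mem_nbrsOn] at hz
      have := hf y hy z hz.1 hz.2
      omega
    have h3 : ∑ z ∈ F y ∪ P y, f z y ≤ ∑ z ∈ nbrsOn G D y, f z y :=
      sum_le_sum_of_subset (union_subset (filter_subset _ _) (filter_subset _ _))
    rw [sum_union hdisj] at h3
    have h4 : #(F y) + (i + 1) * #(P y) ≤ ∑ z ∈ nbrsOn G D y, f z y := by omega
    exact_mod_cast h4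
  have hpot : ∀ y, vertexPotential i j c y ≤ 2 * i + 1 := by
    intro y
    have := hc y
    unfold vertexPotential
    omega
  have hone : ∀ y ∈ D, y ∉ R → #(nbrsOn G S y) + #(P y) ≤ 1 := by
    intro y hy hyR
    by_contra hcon
    have h1 := hunits y hy
    have h2 := hD y hy hyR
    have h3 := hpot y
    have h4 : (2 : ℤ) ≤ #(nbrsOn G S y) + #(P y) := by omega
    have h5 : (0 : ℤ) ≤ #(F y) := by positivity
    have h6 : (i + 1 : ℤ) * 2 ≤ (i + 1) * (#(nbrsOn G S y) + #(P y)) :=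
      mul_le_mul_of_nonneg_left h4 (by positivity)
    linarith
  have hPR : ∀ y ∈ D, y ∈ R → P y = ∅ := by
    intro y hy hyR
    rw [Finset.eq_empty_iff_forall_notMem]
    intro z hz
    obtain ⟨hz, hz0⟩ := mem_filter.1 hz
    have h1 := (hR y hyR).2.1 z hz
    rw [mem_nbrsOn] at hz
    have := hf y hy z hz.1 hz.2
    omega
  let par : V → Option V := fun y =>
    if h : y ∉ R ∧ ¬ (nbrsOn G S y).Nonempty ∧ (P y).Nonempty then some h.2.2.choose else none
  let τ : V → Bool := fun y =>
    if h : y ∉ R ∧ (nbrsOn G S y).Nonempty then φ₀ h.2.choose ^^ !K s(y, h.2.choose) else true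
  have hpar : ∀ y u, par y = some u → u ∈ P y := by
    intro y u hu
    simp only [par] at hu
    split_ifs at hu with h
    rw [← Option.some.inj hu]
    exact h.2.2.choose_spec
  obtain ⟨φ', hφ1, hφ2⟩ := exists_parent_coloring K D par τ (by
    intro v hv u hu
    have := mem_nbrsOn.1 (mem_filter.1 (hpar v u hu)).1
    exact ⟨this.1, this.2.ne'⟩)
  let φ : V → Bool := fun v => if v ∈ D then φ' v else φ₀ v
  have hφD : ∀ v ∈ D, φ v = φ' v := fun v hv => by simp [φ, hv]
  have hφS : ∀ v ∈ S, φ v = φ₀ v := fun v hv => by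
    simp [φ, Finset.disjoint_left.1 hSD hv]
  have hext : ∀ s ∈ S, ∀ y ∈ D, G.Adj y s → (φ y ^^ φ s) = K s(y, s) → y ∈ R ∧ φ y = true := by
    intro s hs y hy hadj hconf
    rw [hφD y hy, hφS s hs] at hconf
    rw [hφD y hy]
    by_cases hyR : y ∈ R
    · refine ⟨hyR, ?_⟩
      rw [hφ1 y hy (by simp [par, hyR])]
      simp [τ, hyR]
    · exfalso
      have hsn : s ∈ nbrsOn G S y := mem_nbrsOn.2 ⟨hs, hadj⟩
      have hne : (nbrsOn G S y).Nonempty := ⟨s, hsn⟩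
      have hle : #(nbrsOn G S y) ≤ 1 := by have := hone y hy hyR; omega
      have hτ : τ y = (φ₀ s ^^ !K s(y, s)) := by
        have hch : y ∉ R ∧ (nbrsOn G S y).Nonempty := ⟨hyR, hne⟩
        simp only [τ, hch, dite_true, and_self, not_false_eq_true]
        rw [Finset.card_le_one.1 hle _ hne.choose_spec _ hsn]
      rw [hφ1 y hy (dif_neg fun h => h.2.1 hne), hτ] at hconf
      revert hconf
      cases φ₀ s <;> cases K s(y, s) <;> simp
  refine ⟨φ, hφS, ?_, hext⟩
  intro y hy
  -- the children of `y` that conflict with it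
  let C : Finset V := {z ∈ D | par z = some y ∧ (φ' z ^^ φ' y) = K s(z, y)}
  have hsub : conflictsOn G K φ (S ∪ D) y
      ⊆ conflictsOn G K φ S y ∪ (F y ∪ (conflictsOn G K φ (P y) y ∪ C)) := by
    intro z hz
    rw [mem_conflictsOn, mem_union] at hz
    obtain ⟨hzS | hzD, hadj, hconf⟩ := hz
    · exact mem_union_left _ (mem_conflictsOn.2 ⟨hzS, hadj, hconf⟩)
    · refine mem_union_right _ ?_
      have hzn : z ∈ nbrsOn G D y := mem_nbrsOn.2 ⟨hzD, hadj⟩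
      by_cases h1 : f y z = 0
      · exact mem_union_right _ (mem_union_left _ (mem_conflictsOn.2
          ⟨mem_filter.2 ⟨hzn, h1⟩, hadj, hconf⟩))
      by_cases h2 : f z y = 0
      · refine mem_union_right _ (mem_union_right _ (mem_filter.2 ⟨hzD, ?_, ?_⟩))
        · have hyP : y ∈ P z := mem_filter.2 ⟨mem_nbrsOn.2 ⟨hy, hadj.symm⟩, h2⟩
          have hzR : z ∉ R := fun hzR => by
            have := hPR z hzD hzR
            rw [this] at hyP
            simp at hyP
          have h3 := hone z hzD hzR
          have h4 : 0 < #(P z) := card_pos.2 ⟨y, hyP⟩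
          have h5 : ¬ (nbrsOn G S z).Nonempty := by
            rw [← card_pos]
            omega
          have h6 : z ∉ R ∧ ¬ (nbrsOn G S z).Nonempty ∧ (P z).Nonempty := ⟨hzR, h5, y, hyP⟩
          simp only [par, dif_pos h6]
          rw [Finset.card_le_one.1 (by omega) _ h6.2.2.choose_spec _ hyP]
        · rw [hφD y hy, hφD z hzD] at hconf
          rw [Bool.xor_comm, hconf, Sym2.eq_swap]
      · exact mem_union_left _ (mem_filter.2 ⟨hzn, h1, h2⟩)
  have hcard : #(conflictsOn G K φ (S ∪ D) y)
      ≤ #(conflictsOn G K φ S y) + (#(F y) + (#(conflictsOn G K φ (P y) y) + #C)) :=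
    (card_le_card hsub).trans ((card_union_le _ _).trans (Nat.add_le_add_left
      ((card_union_le _ _).trans (Nat.add_le_add_left (card_union_le _ _) _)) _))
  have hC1 : #C ≤ 1 := by
    rw [Finset.card_le_one]
    intro a ha b hb
    simp only [C, mem_filter] at ha hb
    exact (hφ2 b hb.1 y hb.2.1 hb.2.2).2.2.2 a ha.1 ha.2.1 ha.2.2
  have hC2 : #C ≠ 0 → φ y = true ∧ par y ≠ none := by
    intro h0
    obtain ⟨a, ha⟩ := card_pos.1 (Nat.pos_of_ne_zero h0)
    simp only [C, mem_filter] at ha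
    have := hφ2 a ha.1 y ha.2.1 ha.2.2
    rw [hφD y hy]
    exact ⟨this.2.1, this.2.2.1⟩
  have hCn : par y = none → #C = 0 := fun h => by
    by_contra h0
    exact (hC2 h0).2 h
  have hS0 : y ∉ R → #(conflictsOn G K φ S y) = 0 := by
    intro hyR
    rw [card_eq_zero, Finset.eq_empty_iff_forall_notMem]
    intro s hs
    rw [mem_conflictsOn] at hs
    exact hyR (hext s hs.1 y hy hs.2.1 hs.2.2).1
  have hPle : #(conflictsOn G K φ (P y) y) ≤ #(P y) :=
    card_le_card fun z hz => (mem_conflictsOn.1 hz).1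
  have hu := hunits y hy
  have hcy := hc y
  by_cases hyR : y ∈ R
  · -- exceptional vertices
    have hpn : par y = none := dif_neg fun h => h.1 hyR
    have hrich : φ y = true := by
      rw [hφD y hy, hφ1 y hy hpn]
      simp [τ, hyR]
    have h1 := hR y hyR
    have h2 : #(conflictsOn G K φ S y) ≤ 1 := by
      rw [← h1.1]
      exact card_le_card fun z hz => by
        rw [mem_conflictsOn] at hz
        exact mem_nbrsOn.2 ⟨hz.1, hz.2.1⟩
    have h3 := h1.2.2
    have h4 := hCn hpn
    rw [hPR y hy hyR] at hPle hcard hu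
    simp only [card_empty, Nat.cast_zero, mul_zero] at hu hPle
    unfold vertexPotential at h3
    rw [hrich]
    omega
  have h1 := hD y hy hyR
  have h2 := hone y hy hyR
  have h3 := hS0 hyR
  unfold vertexPotential at h1
  by_cases hSn : (nbrsOn G S y).Nonempty
  · have hpn : par y = none := dif_neg fun h => h.2.1 hSn
    have h4 := hCn hpn
    have h5 := card_pos.2 hSn
    have h6 : #(nbrsOn G S y) = 1 := by omega
    have h7 : #(P y) = 0 := by omega
    rw [h6] at h1
    rw [h7] at hu
    simp only [Nat.cast_zero, mul_zero, Nat.cast_one, mul_one] at hu h1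
    cases φ y <;> omega
  have h5 : #(nbrsOn G S y) = 0 := by
    rw [← card_pos] at hSn
    omega
  rw [h5] at h1 h2
  simp only [Nat.cast_zero, mul_zero] at h1
  by_cases hPn : (P y).Nonempty
  · have h6 := card_pos.2 hPn
    have h7 : #(P y) = 1 := by omega
    rw [h7] at hu
    simp only [Nat.cast_one, mul_one] at hu
    have hpar' : y ∉ R ∧ ¬ (nbrsOn G S y).Nonempty ∧ (P y).Nonempty := ⟨hyR, hSn, hPn⟩
    -- a poor vertex conflicts neither with its parent nor with its children
    have hpoor : φ y = false → #(conflictsOn G K φ (P y) y) = 0 ∧ #C = 0 := by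
      intro hy0
      constructor
      · rw [card_eq_zero, Finset.eq_empty_iff_forall_notMem]
        intro z hz
        rw [mem_conflictsOn] at hz
        have hzD : z ∈ D := (mem_nbrsOn.1 (mem_filter.1 hz.1).1).1
        have hpz : par y = some z := by
          simp only [par, dif_pos hpar']
          rw [Finset.card_le_one.1 (by omega) _ hPn.choose_spec _ hz.1]
        have h8 := hz.2.2
        rw [hφD y hy, hφD z hzD] at h8
        have := (hφ2 y hy z hpz h8).1
        rw [← hφD y hy, hy0] at this
        exact absurd this (by simp)
      · by_contra h0
        rw [(hC2 h0).1] at hy0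
        exact absurd hy0 (by simp)
    cases hyc : φ y
    · have := hpoor hyc
      omega
    · omega
  · have hpn : par y = none := dif_neg fun h => hPn h.2.2
    have h4 := hCn hpn
    have h6 : #(P y) = 0 := by
      rw [← card_pos] at hPn
      omega
    rw [h6] at hu
    simp only [Nat.cast_zero, mul_zero] at hu
    have hrich : φ y = true := by
      rw [hφD y hy, hφ1 y hy hpn]
      simp [τ, hSn]
    rw [hrich]
    omega

end Extension

/-! ### Signed multigraphs whose edges load one end -/

section Virtual

variable {V : Type*} [DecidableEq V] {i j : ℕ} {c : V → Bool → ℤ}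

/-- Colourings of a signed multigraph in which every conflicting edge loads only one of its ends.
Such an edge stands for a vertex of degree two, which can always avoid a conflict with one of
its two neighbours, and it costs one unit of potential.

If no set of vertices has negative potential, the loads can be distributed such that even the
all-rich colouring works. Otherwise a minimal set of negative potential is coloured first, with a
single vertex `a` of it taking all the excess: all other vertices of the set are rich,
and the load that `a` may receive is at most one more than the sum of its two capacities. -/
lemma exists_virtual_coloring {ε : Type*} [DecidableEq ε] (hj : 2 * i + 1 ≤ j)
    (s t : ε → V) (κ : ε → Bool) (B : Finset V) (X : Finset ε)
    (hc : ∀ v, c v false ≤ i ∧ c v true ≤ j)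
    (hX : ∀ x ∈ X, s x ∈ B ∧ t x ∈ B ∧ s x ≠ t x)
    (h : ∀ T ⊆ B, T.Nonempty →
      (i - j : ℤ) ≤ ∑ v ∈ T, vertexPotential i j c v - #{x ∈ X | s x ∈ T ∧ t x ∈ T}) :
    ∃ (ψ : V → Bool) (o : ε → V), (∀ x ∈ X, o x = s x ∨ o x = t x) ∧
      ∀ v ∈ B, (#{x ∈ X | o x = v ∧ (ψ (s x) ^^ ψ (t x)) = κ x} : ℤ) ≤ c v (ψ v) := by
  induction hn : #B using Nat.strong_induction_on generalizing B X c with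
  | _ n ih =>
  have hrich : ∀ v, vertexPotential i j c v ≤ c v true := by
    intro v
    have := hc v
    unfold vertexPotential
    omega
  let ρ : Finset V → ℤ := fun T =>
    ∑ v ∈ T, vertexPotential i j c v - #{x ∈ X | s x ∈ T ∧ t x ∈ T}
  by_cases hneg : ∃ T ⊆ B, ρ T < 0
  swap
  · push Not at hneg
    obtain ⟨o, ho, hob⟩ := exists_orientation X s t B (vertexPotential i j c)
      (fun x hx => ⟨(hX x hx).1, (hX x hx).2.1⟩) (fun T hT => by
        have := hneg T hT
        simp only [ρ] at this
        omega)
    refine ⟨fun _ => true, o, ho, fun v hv => ?_⟩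
    have h1 : #{x ∈ X | o x = v ∧ (true ^^ true) = κ x} ≤ #{x ∈ X | o x = v} :=
      card_le_card fun x hx => by
        rw [mem_filter] at hx ⊢
        exact ⟨hx.1, hx.2.1⟩
    have h2 := hob v hv
    have h3 := hrich v
    simp only at h1 ⊢
    omega
  obtain ⟨A, hA, hAmin⟩ := exists_min_image (B.powerset.filter fun T => ρ T < 0) card (by
    obtain ⟨T, hT, hT'⟩ := hneg
    exact ⟨T, mem_filter.2 ⟨mem_powerset.2 hT, hT'⟩⟩)
  simp only [mem_filter, mem_powerset] at hA hAmin
  obtain ⟨hAB, hAneg⟩ := hA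
  have hAne : A.Nonempty := by
    rw [nonempty_iff_ne_empty]
    rintro rfl
    simp [ρ] at hAneg
  obtain ⟨a, ha⟩ := hAne
  -- the minimal negative set
  let X₀ : Finset ε := {x ∈ X | s x ∈ A ∧ t x ∈ A}
  have hX₀ : ∀ T ⊆ A, #{x ∈ X₀ | s x ∈ T ∧ t x ∈ T} = #{x ∈ X | s x ∈ T ∧ t x ∈ T} := by
    intro T hT
    congr 1
    ext x
    simp only [X₀, mem_filter]
    constructor
    · rintro ⟨⟨h1, -⟩, h2⟩
      exact ⟨h1, h2⟩
    · rintro ⟨h1, h2⟩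
      exact ⟨⟨h1, hT h2.1, hT h2.2⟩, h2⟩
  obtain ⟨o₀, ho₀, hob₀⟩ := exists_orientation X₀ s t A
    (fun v => vertexPotential i j c v + if v = a then (j - i : ℤ) else 0)
    (fun x hx => (mem_filter.1 hx).2) (fun T hT => by
      rw [hX₀ T hT, sum_add_distrib, sum_ite_eq']
      split_ifs with haT
      · have := h T (hT.trans hAB) ⟨a, haT⟩
        omega
      · have : 0 ≤ ρ T := by
          by_contra hlt
          have h1 := hAmin T ⟨hT.trans hAB, by omega⟩
          rw [Finset.eq_of_subset_of_card_le hT h1] at haT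
          exact haT ha
        simp only [ρ] at this
        omega)
  obtain ⟨k, hk⟩ : ∃ k : Bool,
      (#{x ∈ X₀ | o₀ x = a ∧ (k ^^ true) = κ x} : ℤ) ≤ c a k := by
    by_contra hcon
    push Not at hcon
    have h1 := hcon true
    have h2 := hcon false
    have h3 := hob₀ a ha
    simp only [if_true, vertexPotential] at h3
    have h4 : #{x ∈ X₀ | o₀ x = a ∧ (true ^^ true) = κ x}
        + #{x ∈ X₀ | o₀ x = a ∧ (false ^^ true) = κ x} ≤ #{x ∈ X₀ | o₀ x = a} := by
      rw [← card_union_of_disjoint]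
      · refine card_le_card fun x hx => ?_
        simp only [mem_union, mem_filter] at hx ⊢
        tauto
      · rw [Finset.disjoint_left]
        intro x hx hx'
        simp only [mem_filter] at hx hx'
        have := hx.2.2.trans hx'.2.2.symm
        simp at this
    omega
  let ψ₀ : V → Bool := fun v => if v = a then k else true
  have hψ₀ : ∀ v ∈ A, (#{x ∈ X₀ | o₀ x = v ∧ (ψ₀ (s x) ^^ ψ₀ (t x)) = κ x} : ℤ) ≤ c v (ψ₀ v) := by
    intro v hv
    by_cases hva : v = a
    · subst hva
      have hsub : #{x ∈ X₀ | o₀ x = v ∧ (ψ₀ (s x) ^^ ψ₀ (t x)) = κ x}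
          ≤ #{x ∈ X₀ | o₀ x = v ∧ (k ^^ true) = κ x} := by
        refine card_le_card fun x hx => ?_
        rw [mem_filter] at hx ⊢
        refine ⟨hx.1, hx.2.1, ?_⟩
        rw [← hx.2.2]
        have hne := (hX x (mem_filter.1 hx.1).1).2.2
        rcases ho₀ x hx.1 with h1 | h1
        · have h2 : s x = v := h1.symm.trans hx.2.1
          have h3 : t x ≠ v := fun h => hne (h2.trans h.symm)
          simp [ψ₀, h2, h3]
        · have h2 : t x = v := h1.symm.trans hx.2.1
          have h3 : s x ≠ v := fun h => hne (h.trans h2.symm)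
          simp [ψ₀, h2, h3]
      have : ψ₀ v = k := by simp [ψ₀]
      rw [this]
      omega
    · have h1 : #{x ∈ X₀ | o₀ x = v ∧ (ψ₀ (s x) ^^ ψ₀ (t x)) = κ x} ≤ #{x ∈ X₀ | o₀ x = v} :=
        card_le_card fun x hx => by
          rw [mem_filter] at hx ⊢
          exact ⟨hx.1, hx.2.1⟩
      have h2 := hob₀ v hv
      have h3 := hrich v
      have h4 : ψ₀ v = true := by simp [ψ₀, hva]
      rw [if_neg hva] at h2
      rw [h4]
      omega
  -- the edges leaving the minimal negative set load their outer ends `w x`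
  let w : ε → V := fun x => if s x ∈ A then t x else s x
  let q : ε → V := fun x => if s x ∈ A then s x else t x
  let Xc : Finset ε := {x ∈ X | ¬ (s x ∈ A ↔ t x ∈ A)}
  let N : V → Bool → Finset ε := fun v k => {x ∈ Xc | w x = v ∧ (k ^^ ψ₀ (q x)) = κ x}
  let X₁ : Finset ε := {x ∈ X | s x ∉ A ∧ t x ∉ A}
  let c' : V → Bool → ℤ := fun v k => c v k - #(N v k)
  have hN : ∀ v, #(N v false) + #(N v true) ≤ #{x ∈ Xc | w x = v} := by
    intro v
    rw [← card_union_of_disjoint]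
    · refine card_le_card fun x hx => ?_
      simp only [N, mem_union, mem_filter] at hx ⊢
      tauto
    · rw [Finset.disjoint_left]
      intro x hx hx'
      simp only [N, mem_filter] at hx hx'
      have := hx.2.2.trans hx'.2.2.symm
      simp at this
  obtain ⟨ψ₁, o₁, ho₁, hψ₁⟩ := ih #(B \ A) (by
      rw [← hn]
      exact card_lt_card ⟨sdiff_subset, fun hsub => (mem_sdiff.1 (hsub (hAB ha))).2 ha⟩)
    (B := B \ A) (X := X₁) (c := c')
    (fun v => by
      have := hc v
      simp only [c']
      omega)
    (fun x hx => by
      simp only [X₁, mem_filter] at hx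
      have := hX x hx.1
      exact ⟨mem_sdiff.2 ⟨this.1, hx.2.1⟩, mem_sdiff.2 ⟨this.2.1, hx.2.2⟩, this.2.2⟩)
    (fun T hT hTne => by
      have hdisj : Disjoint T A := by
        rw [Finset.disjoint_left]
        exact fun v hv => (mem_sdiff.1 (hT hv)).2
      have h1 := h (T ∪ A) (union_subset (hT.trans sdiff_subset) hAB) (hTne.mono subset_union_left)
      rw [sum_union hdisj] at h1
      simp only [ρ] at hAneg
      have h2 : ∑ v ∈ T, vertexPotential i j c v - ∑ v ∈ T, (#{x ∈ Xc | w x = v} : ℤ)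
          ≤ ∑ v ∈ T, vertexPotential i j c' v := by
        rw [← sum_sub_distrib]
        refine sum_le_sum fun v _ => ?_
        have := hN v
        simp only [vertexPotential, c']
        omega
      have h3 : ∑ v ∈ T, #{x ∈ Xc | w x = v} = #{x ∈ Xc | w x ∈ T} := by
        rw [card_eq_sum_card_fiberwise (f := w) (s := {x ∈ Xc | w x ∈ T}) (t := T)
          (fun x hx => (mem_filter.1 hx).2)]
        refine sum_congr rfl fun v hv => ?_
        congr 1
        ext x
        simp only [mem_filter]
        constructor
        · rintro ⟨h1, rfl⟩
          exact ⟨⟨h1, hv⟩, rfl⟩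
        · rintro ⟨⟨h1, -⟩, h2⟩
          exact ⟨h1, h2⟩
      have h4 : #{x ∈ Xc | w x ∈ T} + #{x ∈ X₁ | s x ∈ T ∧ t x ∈ T}
          + #{x ∈ X | s x ∈ A ∧ t x ∈ A} ≤ #{x ∈ X | s x ∈ T ∪ A ∧ t x ∈ T ∪ A} := by
        rw [← card_union_of_disjoint, ← card_union_of_disjoint]
        · refine card_le_card fun x hx => ?_
          simp only [mem_union, mem_filter, Xc, X₁, w] at hx ⊢
          rcases hx with (⟨⟨h1, h2⟩, h3⟩ | ⟨⟨h1, -⟩, h2⟩) | ⟨h1, h2⟩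
          · split_ifs at h3 with h5
            · exact ⟨h1, Or.inr h5, Or.inl h3⟩
            · exact ⟨h1, Or.inl h3, Or.inr (by tauto)⟩
          · exact ⟨h1, Or.inl h2.1, Or.inl h2.2⟩
          · exact ⟨h1, Or.inr h2.1, Or.inr h2.2⟩
        · rw [Finset.disjoint_left]
          intro x hx hx'
          simp only [mem_union, mem_filter, Xc, X₁] at hx hx'
          tauto
        · rw [Finset.disjoint_left]
          intro x hx hx'
          simp only [mem_filter, Xc, X₁] at hx hx'
          tauto
      have h5 : ((∑ v ∈ T, #{x ∈ Xc | w x = v} : ℕ) : ℤ) = ∑ v ∈ T, (#{x ∈ Xc | w x = v} : ℤ) := by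
        push_cast
        rfl
      omega) rfl
  refine ⟨fun v => if v ∈ A then ψ₀ v else ψ₁ v,
    fun x => if s x ∈ A then (if t x ∈ A then o₀ x else t x)
      else (if t x ∈ A then s x else o₁ x), ?_, ?_⟩
  · intro x hx
    beta_reduce
    split_ifs with h1 h2 h2
    · exact ho₀ x (mem_filter.2 ⟨hx, h1, h2⟩)
    · exact Or.inr rfl
    · exact Or.inl rfl
    · exact ho₁ x (mem_filter.2 ⟨hx, h1, h2⟩)
  · intro v hv
    by_cases hvA : v ∈ A
    · simp only [hvA, if_true]
      refine le_trans ?_ (hψ₀ v hvA)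
      norm_cast
      refine card_le_card fun x hx => ?_
      rw [mem_filter] at hx ⊢
      obtain ⟨hx, hov, hconf⟩ := hx
      by_cases h1 : s x ∈ A <;> by_cases h2 : t x ∈ A <;>
        simp only [h1, h2, if_true, if_false] at hov hconf
      · exact ⟨mem_filter.2 ⟨hx, h1, h2⟩, hov, hconf⟩
      · rw [hov] at h2
        exact absurd hvA h2
      · rw [hov] at h1
        exact absurd hvA h1
      · have := ho₁ x (mem_filter.2 ⟨hx, h1, h2⟩)
        rw [hov] at this
        rcases this with rfl | rfl <;> contradiction
    · simp only [hvA, if_false]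
      have h1 := hψ₁ v (mem_sdiff.2 ⟨hv, hvA⟩)
      simp only [c'] at h1
      have h2 : ∀ x ∈ X, (if s x ∈ A then (if t x ∈ A then o₀ x else t x)
          else (if t x ∈ A then s x else o₁ x)) = v →
          ((if s x ∈ A then ψ₀ (s x) else ψ₁ (s x)) ^^ (if t x ∈ A then ψ₀ (t x) else ψ₁ (t x)))
            = κ x →
          x ∈ ({x ∈ X₁ | o₁ x = v ∧ (ψ₁ (s x) ^^ ψ₁ (t x)) = κ x} : Finset ε) ∪ N v (ψ₁ v) := by
        intro x hx hov hconf
        rw [mem_union]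
        by_cases h1 : s x ∈ A <;> by_cases h2 : t x ∈ A <;>
          simp only [h1, h2, if_true, if_false] at hov hconf
        · have := ho₀ x (mem_filter.2 ⟨hx, h1, h2⟩)
          rw [hov] at this
          rcases this with rfl | rfl <;> contradiction
        · right
          simp only [N, Xc, w, q, mem_filter, h1, h2, if_true]
          exact ⟨⟨hx, by simp⟩, hov, by rw [← hov, Bool.xor_comm, hconf]⟩
        · right
          simp only [N, Xc, w, q, mem_filter, h1, h2, if_false]
          exact ⟨⟨hx, by simp⟩, hov, by rw [← hov, hconf]⟩
        · left
          exact mem_filter.2 ⟨mem_filter.2 ⟨hx, h1, h2⟩, hov, hconf⟩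
      have h3 := (card_le_card (s := ({x ∈ X | (if s x ∈ A then (if t x ∈ A then o₀ x else t x)
          else (if t x ∈ A then s x else o₁ x)) = v ∧
          ((if s x ∈ A then ψ₀ (s x) else ψ₁ (s x)) ^^ (if t x ∈ A then ψ₀ (t x) else ψ₁ (t x)))
            = κ x} : Finset ε)) fun x hx => by
        rw [mem_filter] at hx
        exact h2 x hx.1 hx.2.1 hx.2.2).trans (card_union_le _ _)
      omega

end Virtual

/-! ### Minimal counterexamples -/

section Minimal

variable {V : Type*} {i j : ℕ} {G : SimpleGraph V} {K : Sym2 V → Bool} {c : V → Bool → ℤ}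
  {A S D : Finset V}

lemma conflictsOn_congr {φ φ' : V → Bool} (h : ∀ v ∈ S, φ v = φ' v) {v : V} (hv : v ∈ S) :
    conflictsOn G K φ S v = conflictsOn G K φ' S v := by
  ext w
  simp only [mem_conflictsOn]
  constructor
  · rintro ⟨hw, h1, h2⟩
    rw [h w hw, h v hv] at h2
    exact ⟨hw, h1, h2⟩
  · rintro ⟨hw, h1, h2⟩
    rw [← h w hw, ← h v hv] at h2
    exact ⟨hw, h1, h2⟩

variable [DecidableEq V]

lemma conflictsOn_union (φ : V → Bool) (v : V) :
    conflictsOn G K φ (S ∪ D) v = conflictsOn G K φ S v ∪ conflictsOn G K φ D v := by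
  ext w
  simp [or_and_right]

/-- A colouring of a set whose potential cannot be decreased by adding vertices extends
without any conflict between old and new vertices. -/
lemma exists_respectsOn_union (hi : 1 ≤ i) (hj : 2 * i + 1 ≤ j)
    (hc : ∀ v, c v false ≤ i ∧ c v true ≤ j) (hSD : Disjoint S D)
    (h : ∀ T ⊆ D, potential i j G c S ≤ potential i j G c (S ∪ T))
    {φ₀ : V → Bool} (hφ₀ : RespectsOn G K c S φ₀) : ∃ φ, RespectsOn G K c (S ∪ D) φ := by
  obtain ⟨f, hf, hfb⟩ := exists_units G D (fun _ => i + 1)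
    (fun y => vertexPotential i j c y - (i + 1) * #(nbrsOn G S y)) (fun T hT => by
      have h1 := h T hT
      rw [potential_union (disjoint_of_subset_right hT hSD)] at h1
      rw [sum_const, smul_eq_mul, sum_sub_distrib, ← mul_sum]
      unfold potential at h1
      push_cast
      linarith)
  obtain ⟨φ, hφS, hφD, hext⟩ := exists_extension (K := K) (R := ∅) hi hj hc hSD φ₀ f hf
    (fun y hy _ => by
      have := hfb y hy
      linarith) (by simp)
  refine ⟨φ, fun v hv => ?_⟩
  rcases mem_union.1 hv with hvS | hvD
  · have h1 : conflictsOn G K φ D v = ∅ := by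
      rw [Finset.eq_empty_iff_forall_notMem]
      intro y hy
      rw [mem_conflictsOn] at hy
      have := hext v hvS y hy.1 hy.2.1.symm (by rw [Bool.xor_comm, hy.2.2, Sym2.eq_swap])
      simp at this
    rw [conflictsOn_union, h1, union_empty, conflictsOn_congr hφS hvS, hφS v hvS]
    exact hφ₀ v hvS
  · exact hφD v hvD

/-- Either some proper nonempty subset of `A` has minimum potential among all nonempty
subsets of `A`, or `A` is the only such set. -/
lemma exists_minimizer_or (i j : ℕ) (G : SimpleGraph V) (c : V → Bool → ℤ) (A : Finset V) :
    (∃ Q ⊆ A, Q ≠ A ∧ Q.Nonempty ∧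
      ∀ T ⊆ A, T.Nonempty → potential i j G c Q ≤ potential i j G c T) ∨
    ∀ Q ⊆ A, Q ≠ A → Q.Nonempty → potential i j G c A < potential i j G c Q := by
  by_contra! hcon
  obtain ⟨h1, Q, hQ, hQA, hQne, hle⟩ := hcon
  obtain ⟨Q', hQ', hmin⟩ := exists_min_image (A.powerset.filter fun T => T.Nonempty)
    (potential i j G c) ⟨Q, mem_filter.2 ⟨mem_powerset.2 hQ, hQne⟩⟩
  simp only [mem_filter, mem_powerset] at hQ' hmin
  by_cases hA : Q' = A
  · subst hA
    obtain ⟨T, hT, hTne, hlt⟩ := h1 Q hQ hQA hQne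
    have := hmin T ⟨hT, hTne⟩
    omega
  · obtain ⟨T, hT, hTne, hlt⟩ := h1 Q' hQ'.1 hA hQ'.2
    have := hmin T ⟨hT, hTne⟩
    omega

/-- Every nonempty subset of `A` has potential at least `i - j`. -/
def SparseOn (i j : ℕ) (G : SimpleGraph V) (c : V → Bool → ℤ) (A : Finset V) : Prop :=
  ∀ S ⊆ A, S.Nonempty → (i - j : ℤ) ≤ potential i j G c S

/-- Deleting an edge and lowering all four capacities at its ends by one changes the potential of a
set containing both ends by `(i + 1) - 4`, which is nonnegative. So in a minimal counterexample, for
every edge there is a set of low potential that contains exactly one of the ends. -/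
lemma exists_separating_of_edge (hi : 3 ≤ i) (hc : ∀ v, c v false ≤ i ∧ c v true ≤ j)
    (hA : SparseOn i j G c A) (hno : ¬ ∃ φ, RespectsOn G K c A φ) {u v : V} (huv : G.Adj u v)
    (ih : ∀ c' : V → Bool → ℤ, (∀ v, c' v false ≤ i ∧ c' v true ≤ j) →
      SparseOn i j (G.deleteEdges {s(u, v)}) c' A →
      ∃ φ, RespectsOn (G.deleteEdges {s(u, v)}) K c' A φ) :
    ∃ S ⊆ A, potential i j G c S ≤ i - j + 1 ∧ (u ∈ S ∧ v ∉ S ∨ v ∈ S ∧ u ∉ S) := by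
  have huv' := huv.ne
  let c' : V → Bool → ℤ := fun w b =>
    c w b - (if w = u then 1 else 0) - (if w = v then 1 else 0)
  by_cases hsp : SparseOn i j (G.deleteEdges {s(u, v)}) c' A
  · exfalso
    obtain ⟨φ, hφ⟩ := ih c' (fun w => by
      have := hc w
      simp only [c']
      split_ifs <;> omega) hsp
    refine hno ⟨φ, fun w hw => ?_⟩
    have h1 := hφ w hw
    by_cases hwuv : w = u ∨ w = v
    · let w' : V := if w = u then v else u
      have hsub : conflictsOn G K φ A w
          ⊆ insert w' (conflictsOn (G.deleteEdges {s(u, v)}) K φ A w) := by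
        intro z hz
        rw [mem_conflictsOn] at hz
        rw [mem_insert, mem_conflictsOn]
        by_cases hzw : z = w'
        · exact Or.inl hzw
        · refine Or.inr ⟨hz.1, ?_, hz.2.2⟩
          rw [SimpleGraph.deleteEdges_adj]
          refine ⟨hz.2.1, ?_⟩
          simp only [Set.mem_singleton_iff, Sym2.eq_iff, not_or, not_and]
          simp only [w'] at hzw
          rcases hwuv with rfl | rfl
          · simp only [if_true] at hzw
            exact ⟨fun _ => hzw, fun h => absurd h huv'⟩
          · rw [if_neg huv'.symm] at hzw
            exact ⟨fun h => absurd h.symm huv', fun _ => hzw⟩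
      have h2 := (card_le_card hsub).trans (card_insert_le _ _)
      have h3 : c' w (φ w) = c w (φ w) - 1 := by
        simp only [c']
        rcases hwuv with rfl | rfl
        · simp [huv']
        · simp [huv'.symm]
      omega
    · rw [not_or] at hwuv
      have hsub : conflictsOn G K φ A w ⊆ conflictsOn (G.deleteEdges {s(u, v)}) K φ A w := by
        intro z hz
        rw [mem_conflictsOn] at hz ⊢
        refine ⟨hz.1, ?_, hz.2.2⟩
        rw [SimpleGraph.deleteEdges_adj]
        refine ⟨hz.2.1, ?_⟩
        simp only [Set.mem_singleton_iff, Sym2.eq_iff, not_or, not_and]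
        exact ⟨fun h => absurd h hwuv.1, fun h => absurd h hwuv.2⟩
      have h2 := card_le_card hsub
      simp only [c', hwuv.1, hwuv.2, if_false] at h1
      omega
  · simp only [SparseOn, not_forall] at hsp
    obtain ⟨S, hSA, hSne, hlt⟩ := hsp
    have h0 := hA S hSA hSne
    have h1 : potential i j (G.deleteEdges {s(u, v)}) c' S
        = ∑ w ∈ S, vertexPotential i j c w - (if u ∈ S then 2 else 0) - (if v ∈ S then 2 else 0)
          - (i + 1) * #(edgesOn (G.deleteEdges {s(u, v)}) S) := by
      have : ∀ w, vertexPotential i j c' w = vertexPotential i j c w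
          - (if w = u then 2 else 0) - (if w = v then 2 else 0) := by
        intro w
        simp only [vertexPotential, c']
        split_ifs <;> ring
      simp only [potential, this, sum_sub_distrib, sum_ite_eq']
    have h2 : edgesOn (G.deleteEdges {s(u, v)}) S = (edgesOn G S).erase s(u, v) := by
      ext e
      rw [mem_erase, mem_edgesOn, mem_edgesOn, SimpleGraph.edgeSet_deleteEdges]
      simp only [Set.mem_sdiff, Set.mem_singleton_iff]
      tauto
    rw [h1] at hlt
    have h3 : #(edgesOn (G.deleteEdges {s(u, v)}) S) ≤ #(edgesOn G S) := by
      rw [h2]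
      exact card_le_card (erase_subset _ _)
    have h4 : ((i : ℤ) + 1) * #(edgesOn (G.deleteEdges {s(u, v)}) S) ≤ (i + 1) * #(edgesOn G S) :=
      mul_le_mul_of_nonneg_left (by exact_mod_cast h3) (by positivity)
    refine ⟨S, hSA, ?_⟩
    by_cases hu : u ∈ S <;> by_cases hv : v ∈ S <;>
      simp only [hu, hv, if_true, if_false, potential] at hlt h0 ⊢
    · exfalso
      rw [h2] at hlt
      have h5 := card_erase_add_one (mk_mem_edgesOn.2 ⟨⟨hu, hv⟩, huv⟩)
      rw [← h5] at h0
      push_cast at h0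
      have : (3 : ℤ) ≤ i := by exact_mod_cast hi
      linarith
    · simp
      omega
    · simp
      omega
    · exfalso
      omega

end Minimal

/-! ### Colourings of graphs whose vertex sets have large potential -/

section Main

variable {V : Type*} [DecidableEq V] {i j : ℕ} {G : SimpleGraph V} {K : Sym2 V → Bool}
  {c : V → Bool → ℤ} {A : Finset V}

/-- The sets of low potential given by `exists_separating_of_edge` are very restricted: in a minimal
counterexample, an edge `uv` can only leave a set `S ∋ u` of low potential if `v` has
degree two and full capacities.

For a largest such `S`, colour `S` such that `u` has room for one more conflict, make `v` rich and
use `v` as the exceptional vertex when extending the colouring. Hall's condition is met with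
no edge giving all its units to `v`; this fails only if `v` has two neighbours in `S`, and then `v`
is all that is left outside `S`. -/
lemma degree_eq_two_of_low (hi : 3 ≤ i) (hj : 2 * i + 1 ≤ j)
    (hc : ∀ v, c v false ≤ i ∧ c v true ≤ j) (hA : SparseOn i j G c A)
    (hmin : ∀ Q ⊆ A, Q ≠ A → Q.Nonempty → potential i j G c A < potential i j G c Q)
    (hno : ¬ ∃ φ, RespectsOn G K c A φ)
    (ih : ∀ S ⊆ A, S ≠ A → ∀ c' : V → Bool → ℤ, (∀ v, c' v false ≤ i ∧ c' v true ≤ j) →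
      SparseOn i j G c' S → ∃ φ, RespectsOn G K c' S φ)
    {u v : V} (huv : G.Adj v u) (hv : v ∈ A) {S₀ : Finset V} (hS₀A : S₀ ⊆ A)
    (hu₀ : u ∈ S₀) (hv₀ : v ∉ S₀) (hlow₀ : potential i j G c S₀ ≤ i - j + 1) :
    #(nbrsOn G A v) = 2 ∧ c v false = i ∧ c v true = j := by
  -- a largest low set
  obtain ⟨S, hS', hmax⟩ := exists_max_image
    (A.powerset.filter fun S => u ∈ S ∧ v ∉ S ∧ potential i j G c S ≤ i - j + 1) card
    ⟨S₀, mem_filter.2 ⟨mem_powerset.2 hS₀A, hu₀, hv₀, hlow₀⟩⟩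
  simp only [mem_filter, mem_powerset] at hS' hmax
  obtain ⟨hSA, hu, hvS, hlow⟩ := hS'
  have hS : S ≠ A := fun h => hvS (h ▸ hv)
  have hAne : A.Nonempty := ⟨v, hv⟩
  have hA0 := hA A subset_rfl hAne
  have hS1 := hmin S hSA hS ⟨u, hu⟩
  have hgt : ∀ T ⊆ A, T ≠ A → T.Nonempty → (i - j + 1 : ℤ) ≤ potential i j G c T := by
    intro T h1 h2 h3
    have := hmin T h1 h2 h3
    omega
  have hun : u ∈ nbrsOn G S v := mem_nbrsOn.2 ⟨hu, huv⟩
  have he : 1 ≤ #(nbrsOn G S v) := card_pos.2 ⟨u, hun⟩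
  have hcv := hc v
  have hpot : vertexPotential i j c v ≤ 2 * i + 1 := by
    unfold vertexPotential
    omega
  have hi' : (3 : ℤ) ≤ i := by exact_mod_cast hi
  rcases he.lt_or_eq with he | he
  · -- two neighbours in `S`
    have h1 := potential_insert (i := i) (j := j) (G := G) (c := c) hvS
    have hsub : insert v S ⊆ A := insert_subset hv hSA
    have h2 := hA (insert v S) hsub ⟨v, mem_insert_self v S⟩
    have he2 : #(nbrsOn G S v) = 2 := by
      by_contra hne
      have h3 : (3 : ℤ) ≤ #(nbrsOn G S v) := by omega
      have h4 : ((i : ℤ) + 1) * 3 ≤ (i + 1) * #(nbrsOn G S v) :=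
        mul_le_mul_of_nonneg_left h3 (by positivity)
      linarith
    rw [he2] at h1
    push_cast at h1
    have hall : insert v S = A := by
      by_contra hne
      have := hgt _ hsub hne ⟨v, mem_insert_self v S⟩
      linarith
    refine ⟨?_, ?_⟩
    · rw [← hall]
      rw [← he2]
      congr 1
      ext w
      simp only [mem_nbrsOn, mem_insert]
      constructor
      · rintro ⟨rfl | h, h'⟩
        · exact absurd h' (G.irrefl)
        · exact ⟨h, h'⟩
      · rintro ⟨h, h'⟩
        exact ⟨Or.inr h, h'⟩
    · have h3 : (2 * i + 1 : ℤ) ≤ vertexPotential i j c v := by linarith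
      unfold vertexPotential at h3
      omega
  · exfalso
    have huniq : ∀ s ∈ nbrsOn G S v, s = u := fun s hs =>
      Finset.card_le_one.1 he.ge s hs u hun
    -- colour `S` so that `u` can bear a conflict with `v` rich
    let k : Bool := !K s(v, u)
    let c' : V → Bool → ℤ := fun w b => c w b - if w = u ∧ b = k then 1 else 0
    obtain ⟨φ₀, hφ₀⟩ := ih S hSA hS c' (fun w => by
      have := hc w
      simp only [c']
      split_ifs <;> omega) (fun T hT hTne => by
      have h1 := hgt T (hT.trans hSA) (fun h => hvS (hT (h ▸ hv))) hTne
      have h2 : ∀ w, vertexPotential i j c' w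
          = vertexPotential i j c w - if w = u then 1 else 0 := by
        intro w
        simp only [vertexPotential, c']
        by_cases hw : w = u <;> cases k <;> simp [hw] <;> ring
      have h3 : potential i j G c' T = potential i j G c T - if u ∈ T then 1 else 0 := by
        simp only [potential, h2, sum_sub_distrib, sum_ite_eq']
        ring
      rw [h3]
      split_ifs <;> omega)
    let D : Finset V := A \ S
    have hSD : Disjoint S D := disjoint_sdiff
    have hvD : v ∈ D := mem_sdiff.2 ⟨hv, hvS⟩
    have hDA : D ⊆ A := sdiff_subset
    obtain ⟨f, hf, hfb⟩ := exists_units G D (fun e => if v ∈ e then i else i + 1)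
      (fun y => vertexPotential i j c y - (i + 1) * #(nbrsOn G S y)
        - (if y ∈ nbrsOn G D v then 1 else 0) + if y = v then 1 else 0) (fun T hT => by
      have hTm : ∀ T' : Finset V, v ∉ T' →
          ∑ e ∈ edgesOn G T', (if v ∈ e then i else i + 1) = (i + 1) * #(edgesOn G T') := by
        intro T' hT'
        rw [mul_comm, ← smul_eq_mul, ← sum_const]
        refine sum_congr rfl fun e he => ?_
        rw [if_neg]
        exact fun hve => hT' ((mem_edgesOn.1 he).1 v hve)
      have hTn : ∀ T' ⊆ D, ∑ y ∈ T', (if y ∈ nbrsOn G D v then (1 : ℤ) else 0)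
          = #(nbrsOn G T' v) := by
        intro T' hT'
        rw [sum_boole]
        congr 2
        ext y
        simp only [mem_filter, mem_nbrsOn]
        constructor
        · rintro ⟨h1, -, h2⟩
          exact ⟨h1, h2⟩
        · rintro ⟨h1, h2⟩
          exact ⟨h1, hT' h1, h2⟩
      rw [sum_add_distrib, sum_sub_distrib, sum_sub_distrib, ← mul_sum, sum_ite_eq', hTn T hT]
      by_cases hvT : v ∈ T
      · -- it suffices that the potential drops by at most one
        rw [if_pos hvT]
        obtain ⟨T', hvT', rfl⟩ : ∃ T', v ∉ T' ∧ insert v T' = T :=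
          ⟨T.erase v, notMem_erase v T, insert_erase hvT⟩
        have hT'D : T' ⊆ D := (subset_insert _ _).trans hT
        have h1 := potential_union (i := i) (j := j) (G := G) (c := c)
          (disjoint_of_subset_right hT hSD)
        have h2 := hA (S ∪ insert v T') (union_subset hSA (hT.trans hDA))
          ⟨u, mem_union_left _ hu⟩
        rw [potential_insert hvT'] at h1
        rw [sum_edgesOn_insert G hvT', hTm T' hvT']
        have h3 : ∑ w ∈ nbrsOn G T' v, (if v ∈ s(v, w) then i else i + 1)
            = #(nbrsOn G T' v) * i := by
          simp
        have h4 : #(nbrsOn G (insert v T') v) = #(nbrsOn G T' v) := by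
          congr 1
          ext w
          simp only [mem_nbrsOn, mem_insert]
          constructor
          · rintro ⟨rfl | h, h'⟩
            · exact absurd h' (G.irrefl)
            · exact ⟨h, h'⟩
          · rintro ⟨h, h'⟩
            exact ⟨Or.inr h, h'⟩
        rw [h3, h4, sum_insert hvT']
        unfold potential at h1 hlow h2
        push_cast
        linarith
      · -- every neighbour of `v` in `T` forces the potential up, by the choice of `S`
        rw [if_neg hvT, hTm T hvT]
        have h1 := potential_union (i := i) (j := j) (G := G) (c := c)
          (disjoint_of_subset_right hT hSD)
        have hST : S ∪ T ⊆ A := union_subset hSA (hT.trans hDA)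
        have hvST : v ∉ S ∪ T := by simp [hvS, hvT]
        have h2 := hgt (S ∪ T) hST (fun h => hvST (h ▸ hv)) ⟨u, mem_union_left _ hu⟩
        suffices h : (#(nbrsOn G T v) : ℤ) ≤ potential i j G c (S ∪ T) - potential i j G c S by
          unfold potential at h1 h
          push_cast
          linarith
        rcases Nat.eq_zero_or_pos #(nbrsOn G T v) with h0 | h0
        · rw [h0]
          push_cast
          linarith
        have hlt : (i - j + 1 : ℤ) < potential i j G c (S ∪ T) := by
          by_contra hle
          obtain ⟨y, hy⟩ := card_pos.1 h0
          have hyT := (mem_nbrsOn.1 hy).1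
          have h3 := hmax (S ∪ T) ⟨hST, mem_union_left _ hu, hvST, not_lt.1 hle⟩
          have h4 := eq_of_subset_of_card_le subset_union_left h3
          have h5 : y ∈ S := h4 ▸ mem_union_right _ hyT
          exact Finset.disjoint_left.1 hSD h5 (hT hyT)
        rcases Nat.lt_or_ge 1 #(nbrsOn G T v) with h6 | h6
        · have h3 := hA (insert v (S ∪ T)) (insert_subset hv hST) ⟨v, mem_insert_self _ _⟩
          rw [potential_insert hvST, nbrsOn_union,
            card_union_of_disjoint (disjoint_nbrsOn G (disjoint_of_subset_right hT hSD) v),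
            ← he] at h3
          have h7 : (2 : ℤ) ≤ #(nbrsOn G T v) := by exact_mod_cast h6
          push_cast at h3
          nlinarith
        · have h7 : (#(nbrsOn G T v) : ℤ) ≤ 1 := by exact_mod_cast h6
          linarith)
    let f' : V → V → ℕ := fun y z => f y z + if y = v then 1 else 0
    have hsum : ∀ y ∈ D, ∑ z ∈ nbrsOn G D y, f' z y
        = ∑ z ∈ nbrsOn G D y, f z y + if y ∈ nbrsOn G D v then 1 else 0 := by
      intro y hy
      simp only [f']
      rw [sum_add_distrib, sum_ite_eq']
      congr 1
      by_cases h : G.Adj v y <;> simp [hvD, hy, h, G.adj_comm y v]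
    obtain ⟨φ, hφS, hφD, hext⟩ := exists_extension (K := K) (c := c) (R := {v}) (by omega) hj hc
      hSD φ₀ f' (fun y hy z hz hyz => by
        have h1 := hf y hy z hz hyz
        have h2 := hyz.ne
        simp only [f']
        simp only [Sym2.mem_iff] at h1
        by_cases hyv : y = v
        · have hzv : z ≠ v := fun h => h2 (hyv.trans h.symm)
          simp only [hyv, hzv, true_or, if_true, if_false] at h1 ⊢
          omega
        · by_cases hzv : z = v
          · simp only [hzv, or_true, if_true, hyv, if_false] at h1 ⊢
            omega
          · simp only [hyv, hzv, if_false, Ne.symm hyv, Ne.symm hzv, or_self] at h1 ⊢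
            omega)
      (fun y hy hyR => by
        rw [mem_singleton] at hyR
        have h1 := hfb y hy
        rw [hsum y hy]
        rw [if_neg hyR] at h1
        push_cast
        push_cast at h1
        linarith)
      (fun y hy => by
        rw [mem_singleton] at hy
        subst hy
        refine ⟨he.symm, ?_, ?_⟩
        · intro z hz
          rw [mem_nbrsOn] at hz
          have h1 := hf y hvD z hz.1 hz.2
          have h2 := hz.2.ne'
          simp only [Sym2.mem_iff, true_or, if_true] at h1
          simp only [f', if_neg h2]
          omega
        · have h1 := hfb y hvD
          have h2 : y ∉ nbrsOn G D y := by simp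
          rw [hsum y hvD]
          rw [if_neg h2, ← he] at h1
          rw [if_neg h2]
          simp only [if_true] at h1
          push_cast
          push_cast at h1
          linarith)
    refine hno ⟨φ, fun w hw => ?_⟩
    have hunion : A = S ∪ D := (union_sdiff_of_subset hSA).symm
    by_cases hwS : w ∈ S
    · have h1 := hφ₀ w hwS
      rw [← conflictsOn_congr hφS hwS, ← hφS w hwS] at h1
      have h2 : ∀ y ∈ conflictsOn G K φ D w, y = v ∧ w = u ∧ φ u = k := by
        intro y hy
        rw [mem_conflictsOn] at hy
        obtain ⟨hyD, hwy, hconf⟩ := hy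
        have hconf' : (φ y ^^ φ w) = K s(y, w) := by rw [Bool.xor_comm, hconf, Sym2.eq_swap]
        obtain ⟨h3, h4⟩ := hext w hwS y hyD hwy.symm hconf'
        rw [mem_singleton] at h3
        subst h3
        have h5 := huniq w (mem_nbrsOn.2 ⟨hwS, hwy.symm⟩)
        subst h5
        refine ⟨rfl, rfl, ?_⟩
        simp only [k]
        rw [← hconf', h4]
        simp
      have h3 : #(conflictsOn G K φ D w) ≤ 1 :=
        Finset.card_le_one.2 fun a ha b hb => (h2 a ha).1.trans (h2 b hb).1.symm
      have h4 := card_union_le (conflictsOn G K φ S w) (conflictsOn G K φ D w)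
      rw [← conflictsOn_union, ← hunion] at h4
      rcases Nat.eq_zero_or_pos #(conflictsOn G K φ D w) with h5 | h5
      · simp only [c'] at h1
        split_ifs at h1 <;> omega
      · obtain ⟨y, hy⟩ := card_pos.1 h5
        obtain ⟨-, h6, h7⟩ := h2 y hy
        rw [← h6] at h7
        simp only [c', h6, true_and] at h1
        rw [← h6, if_pos h7] at h1
        omega
    · have := hφD w (mem_sdiff.2 ⟨hw, hwS⟩)
      rwa [← hunion] at this

/-- The case of `exists_respectsOn` in which the graph is bipartite, one side consisting of
vertices of degree two with full capacities. -/
lemma exists_respectsOn_of_bipartite (hi : 1 ≤ i) (hj : 2 * i + 1 ≤ j)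
    (hc : ∀ v, c v false ≤ i ∧ c v true ≤ j) (hA : SparseOn i j G c A) {X : Finset V}
    (hXA : X ⊆ A) (hX : ∀ x ∈ X, #(nbrsOn G A x) = 2 ∧ c x false = i ∧ c x true = j)
    (hind : ∀ x ∈ X, ∀ y ∈ X, ¬ G.Adj x y)
    (hcov : ∀ u ∈ A, ∀ v ∈ A, G.Adj u v → u ∈ X ∨ v ∈ X) :
    ∃ φ, RespectsOn G K c A φ := by
  have hends : ∀ x ∈ X, ∃ p q, p ≠ q ∧ nbrsOn G A x = {p, q} := fun x hx =>
    card_eq_two.1 (hX x hx).1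
  choose! s t hst hnbr using hends
  have hmem : ∀ x ∈ X, ∀ w, w ∈ A ∧ G.Adj x w ↔ w = s x ∨ w = t x := by
    intro x hx w
    rw [← mem_nbrsOn, hnbr x hx]
    simp
  have hB : ∀ x ∈ X, s x ∈ A \ X ∧ t x ∈ A \ X := by
    intro x hx
    have h1 := (hmem x hx (s x)).2 (Or.inl rfl)
    have h2 := (hmem x hx (t x)).2 (Or.inr rfl)
    exact ⟨mem_sdiff.2 ⟨h1.1, fun h => hind x hx _ h h1.2⟩,
      mem_sdiff.2 ⟨h2.1, fun h => hind x hx _ h h2.2⟩⟩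
  obtain ⟨ψ, o, ho, hψ⟩ := exists_virtual_coloring (c := c) hj s t
    (fun x => !(K s(x, s x) ^^ K s(x, t x))) (A \ X) X hc
    (fun x hx => ⟨(hB x hx).1, (hB x hx).2, hst x hx⟩) (fun T hT hTne => by
      let Y : Finset V := {x ∈ X | s x ∈ T ∧ t x ∈ T}
      have hYX : Y ⊆ X := filter_subset _ _
      have hTY : Disjoint T Y := by
        rw [Finset.disjoint_left]
        intro w hw hwY
        exact (mem_sdiff.1 (hT hw)).2 (hYX hwY)
      have h1 := hA (T ∪ Y) (union_subset (hT.trans sdiff_subset) (hYX.trans hXA))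
        (hTne.mono subset_union_left)
      rw [potential_union hTY] at h1
      have h2 : ∑ y ∈ Y, (#(nbrsOn G T y) : ℤ) = #Y * 2 := by
        rw [← nsmul_eq_mul, ← sum_const]
        refine sum_congr rfl fun y hy => ?_
        obtain ⟨hyX, hsy, hty⟩ := mem_filter.1 hy
        have : nbrsOn G T y = {s y, t y} := by
          ext w
          rw [mem_nbrsOn, mem_insert, mem_singleton, ← hmem y hyX]
          constructor
          · rintro ⟨h1, h2⟩
            exact ⟨(hT.trans sdiff_subset) h1, h2⟩
          · rintro ⟨h1, h2⟩
            refine ⟨?_, h2⟩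
            rcases (hmem y hyX w).1 ⟨h1, h2⟩ with rfl | rfl <;> assumption
        rw [this, card_pair (hst y hyX)]
        rfl
      have h3 : ∑ y ∈ Y, vertexPotential i j c y = #Y * (2 * i + 1) := by
        rw [← nsmul_eq_mul, ← sum_const]
        refine sum_congr rfl fun y hy => ?_
        have := (hX y (hYX hy)).2
        simp only [vertexPotential, this.1, this.2]
        ring
      have h4 : (0 : ℤ) ≤ (i + 1) * #(edgesOn G T) := by positivity
      have h5 : (0 : ℤ) ≤ (i + 1) * #(edgesOn G Y) := by positivity
      rw [h2] at h1
      unfold potential at h1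
      rw [h3] at h1
      change _ ≤ _ - (#Y : ℤ)
      linarith)
  -- each vertex of `X` avoids the neighbour that is not loaded
  let q : V → V := fun x => if o x = s x then t x else s x
  let φ : V → Bool := fun w => if w ∈ X then ψ (q w) ^^ !K s(w, q w) else ψ w
  have hφX : ∀ x ∈ X, φ x = (ψ (q x) ^^ !K s(x, q x)) := fun x hx => by simp [φ, hx]
  have hφB : ∀ w, w ∉ X → φ w = ψ w := fun w hw => by simp [φ, hw]
  have hqX : ∀ x ∈ X, q x ∉ X := by
    intro x hx
    simp only [q]
    split_ifs
    · exact (mem_sdiff.1 (hB x hx).2).2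
    · exact (mem_sdiff.1 (hB x hx).1).2
  have havoid : ∀ x ∈ X, (φ x ^^ φ (q x)) ≠ K s(x, q x) := by
    intro x hx
    rw [hφX x hx, hφB _ (hqX x hx)]
    cases ψ (q x) <;> cases K s(x, q x) <;> simp
  have hor : ∀ x ∈ X, ∀ w, w ∈ A ∧ G.Adj x w → (φ x ^^ φ w) = K s(x, w) →
      o x = w ∧ (ψ (s x) ^^ ψ (t x)) = !(K s(x, s x) ^^ K s(x, t x)) := by
    intro x hx w hw hconf
    have hne : w ≠ q x := by
      rintro rfl
      exact havoid x hx hconf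
    have hwX : w ∉ X := fun h => hind x hx w h hw.2
    rw [hφX x hx, hφB w hwX] at hconf
    have hst' := hst x hx
    rcases ho x hx with h1 | h1
    · have h2 : q x = t x := by simp [q, h1]
      rw [h2] at hne hconf
      rcases (hmem x hx w).1 hw with rfl | rfl
      · refine ⟨h1, ?_⟩
        rw [← hconf]
        cases ψ (s x) <;> cases ψ (t x) <;> cases K s(x, t x) <;> simp
      · exact absurd rfl hne
    · have h2 : q x = s x := by simp [q, h1, hst'.symm]
      rw [h2] at hne hconf
      rcases (hmem x hx w).1 hw with rfl | rfl
      · exact absurd rfl hne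
      · refine ⟨h1, ?_⟩
        rw [← hconf]
        cases ψ (s x) <;> cases ψ (t x) <;> cases K s(x, s x) <;> simp
  refine ⟨φ, fun w hw => ?_⟩
  by_cases hwX : w ∈ X
  · have h1 : #(conflictsOn G K φ A w) ≤ 1 := by
      rw [Finset.card_le_one]
      intro a ha b hb
      rw [mem_conflictsOn] at ha hb
      rw [← (hor w hwX a ⟨ha.1, ha.2.1⟩ ha.2.2).1, ← (hor w hwX b ⟨hb.1, hb.2.1⟩ hb.2.2).1]
    obtain ⟨-, h2, h3⟩ := hX w hwX
    cases φ w <;> omega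
  · have h1 := hψ w (mem_sdiff.2 ⟨hw, hwX⟩)
    rw [hφB w hwX]
    refine le_trans ?_ h1
    norm_cast
    refine card_le_card fun z hz => ?_
    rw [mem_conflictsOn] at hz
    obtain ⟨hzA, hwz, hconf⟩ := hz
    have hzX : z ∈ X := (hcov w hw z hzA hwz).resolve_left hwX
    exact mem_filter.2 ⟨hzX, hor z hzX w ⟨hw, hwz.symm⟩
      (by rw [Bool.xor_comm, hconf, Sym2.eq_swap])⟩

/-- The lower bound in its strongest form: if every nonempty set of vertices has potential at least
`i - j`, then the capacities can be respected. -/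
theorem exists_respectsOn (hi : 3 ≤ i) (hj : 2 * i + 1 ≤ j) (K : Sym2 V → Bool)
    (hc : ∀ v, c v false ≤ i ∧ c v true ≤ j) (hA : SparseOn i j G c A) :
    ∃ φ, RespectsOn G K c A φ := by
  induction hn : #A + #(edgesOn G A) using Nat.strong_induction_on generalizing G c A with
  | _ n ih =>
  have ihS : ∀ S ⊆ A, S ≠ A → ∀ c' : V → Bool → ℤ, (∀ v, c' v false ≤ i ∧ c' v true ≤ j) →
      SparseOn i j G c' S → ∃ φ, RespectsOn G K c' S φ := by
    intro S hSA hS c' hc' hsp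
    refine ih _ ?_ hc' hsp rfl
    rw [← hn]
    have h1 := card_lt_card (hSA.ssubset_of_ne hS)
    have h2 := card_le_card (edgesOn_mono G hSA)
    omega
  rcases exists_minimizer_or i j G c A with ⟨Q, hQA, hQ, hQne, hle⟩ | hmin
  · obtain ⟨φ₀, hφ₀⟩ := ihS Q hQA hQ c hc fun T hT => hA T (hT.trans hQA)
    have := exists_respectsOn_union (by omega) hj hc (disjoint_sdiff (s := Q) (t := A)) (fun T hT =>
      hle (Q ∪ T) (union_subset hQA (hT.trans sdiff_subset)) (hQne.mono subset_union_left)) hφ₀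
    rwa [union_sdiff_of_subset hQA] at this
  by_contra hno
  let X : Finset V := {x ∈ A | #(nbrsOn G A x) = 2 ∧ c x false = i ∧ c x true = j}
  have hXA : X ⊆ A := filter_subset _ _
  refine hno (exists_respectsOn_of_bipartite (by omega) hj hc hA hXA
    (fun x hx => (mem_filter.1 hx).2) ?_ ?_)
  · -- removing two adjacent vertices of degree two would decrease the potential
    intro x hx y hy hxy
    obtain ⟨hxA, hx2, hx3⟩ := mem_filter.1 hx
    obtain ⟨hyA, hy2, hy3⟩ := mem_filter.1 hy
    have hne := hxy.ne
    let T : Finset V := (A.erase x).erase y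
    have hyT : y ∉ T := notMem_erase _ _
    have hxT : x ∉ insert y T := by
      simp [T, hne]
    have hAT : insert x (insert y T) = A := by
      rw [insert_erase (mem_erase.2 ⟨hne.symm, hyA⟩), insert_erase hxA]
    have hnx : #(nbrsOn G (insert y T) x) = 2 := by
      rw [← hx2]
      congr 1
      ext w
      rw [mem_nbrsOn, mem_nbrsOn, ← hAT, mem_insert (b := x)]
      constructor
      · rintro ⟨h1, h2⟩
        exact ⟨Or.inr h1, h2⟩
      · rintro ⟨rfl | h1, h2⟩
        · exact absurd h2 G.irrefl
        · exact ⟨h1, h2⟩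
    have hny : #(nbrsOn G T y) = 1 := by
      have : nbrsOn G T y = (nbrsOn G A y).erase x := by
        ext w
        simp only [T, mem_nbrsOn, mem_erase]
        constructor
        · rintro ⟨⟨-, h1, h2⟩, h3⟩
          exact ⟨h1, h2, h3⟩
        · rintro ⟨h1, h2, h3⟩
          exact ⟨⟨h3.ne', h1, h2⟩, h3⟩
      rw [this, card_erase_of_mem (mem_nbrsOn.2 ⟨hxA, hxy.symm⟩), hy2]
    have hTne : T.Nonempty := by
      obtain ⟨z, hz⟩ := card_pos.1 (by omega : 0 < #(nbrsOn G T y))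
      exact ⟨z, (mem_nbrsOn.1 hz).1⟩
    have h1 := hmin T ((erase_subset _ _).trans (erase_subset _ _))
      (fun h => hyT (h ▸ hyA)) hTne
    rw [← hAT, potential_insert hxT, potential_insert hyT, hnx, hny] at h1
    simp only [vertexPotential, hx3.1, hx3.2, hy3.1, hy3.2] at h1
    push_cast at h1
    have : (3 : ℤ) ≤ i := by exact_mod_cast hi
    linarith
  · intro u hu v hv huv
    obtain ⟨S, hSA, hlow, hsep⟩ := exists_separating_of_edge hi hc hA hno huv
      (fun c' hc' hsp => by
        refine ih _ ?_ hc' hsp rfl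
        rw [← hn]
        refine Nat.add_lt_add_left (card_lt_card ⟨?_, ?_⟩) _
        · intro e he
          rw [mem_edgesOn, SimpleGraph.edgeSet_deleteEdges] at he
          rw [mem_edgesOn]
          exact ⟨he.1, he.2.1⟩
        · intro hsub
          have := hsub (mk_mem_edgesOn.2 ⟨⟨hu, hv⟩, huv⟩)
          rw [mem_edgesOn, SimpleGraph.edgeSet_deleteEdges] at this
          exact this.2.2 rfl)
    rcases hsep with ⟨h1, h2⟩ | ⟨h1, h2⟩
    · exact Or.inr (mem_filter.2 ⟨hv, degree_eq_two_of_low hi hj hc hA hmin hno ihS huv.symm hv hSA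
        h1 h2 hlow⟩)
    · exact Or.inl (mem_filter.2 ⟨hu, degree_eq_two_of_low hi hj hc hA hmin hno ihS huv hu hSA
        h1 h2 hlow⟩)

end Main

/-! ### Covers and critical graphs -/

section Covers

variable {V : Type u} {i j : ℕ} {G : SimpleGraph V}

/-- The capacities of an `(i, j)`-defective colouring: `i` for poor and `j` for rich. -/
def fullCapacity (V : Type*) (i j : ℕ) : V → Bool → ℤ := fun _ b => if b then j else i

lemma vertexPotential_fullCapacity (v : V) :
    vertexPotential i j (fullCapacity V i j) v = 2 * i + 1 := by
  simp [vertexPotential, fullCapacity]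
  ring

lemma potential_fullCapacity (S : Finset V) :
    potential i j G (fullCapacity V i j) S = (2 * i + 1) * #S - (i + 1) * #(edgesOn G S) := by
  simp only [potential, vertexPotential_fullCapacity, sum_const, nsmul_eq_mul]
  ring

lemma card_edgesOn_univ [Fintype V] (G : SimpleGraph V) :
    #(edgesOn G univ) = G.edgeSet.ncard := by
  rw [← Set.ncard_coe_finset]
  congr 1
  ext e
  simp [mem_edgesOn]

/-- The `2`-fold cover of `G` on `V × Bool` given by signs on the edges. -/
def signCover (G : SimpleGraph V) (K : Sym2 V → Bool) : Cover G (V × Bool) where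
  L u := {x | x.1 = u}
  H :=
    { Adj := fun x y => (x.1 = y.1 ∧ x.2 ≠ y.2) ∨ (G.Adj x.1 y.1 ∧ (x.2 ^^ y.2) = K s(x.1, y.1))
      symm := ⟨fun x y h => by
        rcases h with ⟨h1, h2⟩ | ⟨h1, h2⟩
        · exact Or.inl ⟨h1.symm, h2.symm⟩
        · exact Or.inr ⟨h1.symm, by rw [Bool.xor_comm, h2, Sym2.eq_swap]⟩⟩
      loopless := ⟨fun x h => by
        rcases h with ⟨-, h⟩ | ⟨h, -⟩
        · exact h rfl
        · exact G.irrefl h⟩ }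
  pairwise_disjoint u v huv := by
    rw [Set.disjoint_left]
    rintro x rfl hx
    exact huv hx
  iUnion_eq := by
    ext x
    simp
  isClique u := by
    rintro ⟨x, a⟩ rfl ⟨y, b⟩ hy hne
    obtain rfl : y = x := hy
    refine Or.inl ⟨rfl, fun h => hne ?_⟩
    rw [show a = b from h]
  adj_of_adj := by
    rintro u v a rfl b rfl (h | h)
    · exact Or.inl h.1
    · exact Or.inr h.1
  matching := by
    rintro u v huv a rfl b rfl b' hb' (h | h) h'
    · exact absurd h.1 huv.ne
    rcases h' with h' | h'
    · exact absurd (h'.1.trans hb') huv.ne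
    obtain ⟨x, a⟩ := a
    obtain ⟨y, b⟩ := b
    obtain ⟨z, b'⟩ := b'
    obtain rfl : z = y := hb'
    have := h.2.trans h'.2.symm
    simpa using this

/-- Colourability in terms of signs on the edges. As missing matching edges only make colouring
easier, only covers with a perfect matching over each edge matter, and each of these matchings
is either straight (poor to poor, rich to rich) or crossed. -/
lemma isColorable_iff [Fintype V] (G : SimpleGraph V) :
    IsColorable G i j ↔ ∀ K : Sym2 V → Bool, ∃ φ, RespectsOn G K (fullCapacity V i j) univ φ := by
  classical
  constructor
  · intro h K
    have hL : ∀ u, (signCover G K).L u = {(u, false), (u, true)} := by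
      intro u
      ext ⟨x, b⟩
      simp only [signCover, Set.mem_ofPred_eq, Set.mem_insert_iff, Set.mem_singleton_iff,
        Prod.mk.injEq]
      cases b <;> simp
    obtain ⟨φ, ⟨hinj, hmem⟩, hdeg⟩ := h (V × Bool) (signCover G K)
      (fun u => by rw [hL, Set.ncard_pair (by simp)]) (fun u => (u, false)) (fun u => (u, true)) hL
    have hφ : ∀ v, φ v = (v, (φ v).2) := fun v => Prod.ext (hmem v) rfl
    refine ⟨fun v => (φ v).2, fun v _ => ?_⟩
    have h1 : #(conflictsOn G K (fun v => (φ v).2) univ v) ≤ (signCover G K).inducedDegree φ v := by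
      rw [← card_map ⟨φ, hinj⟩, ← Set.ncard_coe_finset]
      refine Set.ncard_le_ncard ?_ (Set.toFinite _)
      intro x hx
      simp only [coe_map, Function.Embedding.coeFn_mk, Set.mem_image, mem_coe,
        mem_conflictsOn] at hx
      obtain ⟨w, ⟨-, hvw, hconf⟩, rfl⟩ := hx
      refine ⟨?_, w, rfl⟩
      rw [SimpleGraph.mem_neighborSet, hφ v, hφ w]
      exact Or.inr ⟨hvw, hconf⟩
    obtain ⟨h2, h3⟩ := hdeg v
    cases hb : (φ v).2
    · have := h2 (by rw [hφ v, hb])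
      simp only [fullCapacity, hb]
      simp
      omega
    · have := h3 (by rw [hφ v, hb])
      simp only [fullCapacity, hb]
      simp
      omega
  · intro h W C hfold p r hL
    have hpr : ∀ u, p u ≠ r u := by
      intro u hu
      have := hfold u
      rw [hL, hu] at this
      simp at this
    have hp : ∀ u, p u ∈ C.L u := fun u => by simp [hL]
    have hr : ∀ u, r u ∈ C.L u := fun u => by simp [hL]
    let K : Sym2 V → Bool := fun e => decide (∃ u v, e = s(u, v) ∧ C.H.Adj (p u) (r v))
    have hK : ∀ u v, K s(u, v) = true ↔ C.H.Adj (p u) (r v) ∨ C.H.Adj (p v) (r u) := by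
      intro u v
      simp only [K, decide_eq_true_eq, Sym2.eq_iff]
      constructor
      · rintro ⟨a, b, ⟨rfl, rfl⟩ | ⟨rfl, rfl⟩, h⟩
        · exact Or.inl h
        · exact Or.inr h
      · rintro (h | h)
        · exact ⟨u, v, Or.inl ⟨rfl, rfl⟩, h⟩
        · exact ⟨v, u, Or.inr ⟨rfl, rfl⟩, h⟩
    obtain ⟨φ, hφ⟩ := h K
    let Φ : V → W := fun v => if φ v then r v else p v
    have hΦ : ∀ v, Φ v ∈ C.L v := by
      intro v
      simp only [Φ]
      split_ifs
      · exact hr v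
      · exact hp v
    have hinj : Function.Injective Φ := by
      intro v w hvw
      by_contra hne
      exact Set.disjoint_left.1 (C.pairwise_disjoint v w hne) (hΦ v) (hvw ▸ hΦ w)
    have hconf : ∀ v w, C.H.Adj (Φ v) (Φ w) → G.Adj v w ∧ (φ v ^^ φ w) = K s(v, w) := by
      intro v w hvw
      have hG : G.Adj v w := by
        rcases C.adj_of_adj v w _ (hΦ v) _ (hΦ w) hvw with rfl | h
        · exact absurd hvw (C.H.irrefl)
        · exact h
      refine ⟨hG, ?_⟩
      have hm := C.matching v w hG
      have hm' := C.matching w v hG.symm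
      simp only [Φ] at hvw
      cases hv : φ v <;> cases hw : φ w <;> simp only [hv, hw, if_true, if_false,
        Bool.false_eq_true] at hvw
      · have : ¬ K s(v, w) = true := by
          rw [hK]
          rintro (h1 | h1)
          · exact hpr w (hm _ (hp v) _ (hp w) _ (hr w) hvw h1)
          · exact hpr v (hm' _ (hp w) _ (hp v) _ (hr v) hvw.symm h1)
        simpa using this
      · have : K s(v, w) = true := (hK v w).2 (Or.inl hvw)
        simp [this]
      · have : K s(v, w) = true := (hK v w).2 (Or.inr hvw.symm)
        simp [this]
      · have : ¬ K s(v, w) = true := by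
          rw [hK]
          rintro (h1 | h1)
          · exact hpr v (hm' _ (hr w) _ (hp v) _ (hr v) h1.symm hvw.symm)
          · exact hpr w (hm _ (hr v) _ (hp w) _ (hr w) h1.symm hvw)
        simpa using this
    have hdeg : ∀ v, (C.inducedDegree Φ v : ℤ) ≤ fullCapacity V i j v (φ v) := by
      intro v
      refine le_trans ?_ (hφ v (mem_univ v))
      have h1 : C.inducedDegree Φ v ≤ ((conflictsOn G K φ univ v).map ⟨Φ, hinj⟩ : Set W).ncard := by
        refine Set.ncard_le_ncard ?_ (Finset.finite_toSet _)
        rintro _ ⟨hx, w, rfl⟩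
        rw [coe_map]
        refine ⟨w, ?_, rfl⟩
        rw [mem_coe, mem_conflictsOn]
        exact ⟨mem_univ w, hconf v w hx⟩
      rw [Set.ncard_coe_finset, card_map] at h1
      exact_mod_cast h1
    refine ⟨Φ, ⟨hinj, hΦ⟩, fun v => ⟨fun hv => ?_, fun hv => ?_⟩⟩
    · have h0 : φ v = false := by
        by_contra h0
        rw [Bool.not_eq_false] at h0
        exact hpr v (by rw [← hv]; simp [Φ, h0])
      have := hdeg v
      rw [h0] at this
      simpa [fullCapacity] using this
    · have h0 : φ v = true := by
        by_contra h0
        rw [Bool.not_eq_true] at h0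
        exact hpr v (by rw [← hv]; simp [Φ, h0])
      have := hdeg v
      rw [h0] at this
      simpa [fullCapacity] using this

lemma IsColorable.of_injective_hom {V' : Type u} [Fintype V] [Fintype V'] {G' : SimpleGraph V'}
    (h : IsColorable G i j) (f : G' →g G) (hf : Function.Injective f) : IsColorable G' i j := by
  classical
  rw [isColorable_iff] at h ⊢
  intro K'
  obtain ⟨φ, hφ⟩ := h fun e => decide (∃ e', e'.map f = e ∧ K' e' = true)
  refine ⟨φ ∘ f, fun v _ => le_trans ?_ (hφ (f v) (mem_univ _))⟩
  rw [← card_map ⟨f, hf⟩]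
  norm_cast
  refine card_le_card ?_
  intro x hx
  obtain ⟨w, hw, rfl⟩ := mem_map.1 hx
  rw [mem_conflictsOn] at hw ⊢
  refine ⟨mem_univ _, f.map_adj hw.2.1, ?_⟩
  have h1 : (∃ e' : Sym2 V', e'.map f = s(f v, f w) ∧ K' e' = true) ↔ K' s(v, w) = true := by
    constructor
    · rintro ⟨e', he', hK⟩
      rw [← Sym2.map_mk] at he'
      rwa [← Sym2.map.injective hf he']
    · exact fun h => ⟨s(v, w), Sym2.map_mk .., h⟩
  have h2 := hw.2.2
  simp only [Function.comp_apply] at h2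
  simp only [Function.Embedding.coeFn_mk, h1, h2]
  simp

lemma IsCritical.of_iso {V' : Type u} [Fintype V] [Fintype V'] {G' : SimpleGraph V'}
    (h : IsCritical G i j) (e : G ≃g G') : IsCritical G' i j := by
  classical
  refine ⟨fun hG' => h.1 (hG'.of_injective_hom e.toHom e.injective), fun S hS => ?_⟩
  have hne : S.comap e.toHom ≠ ⊤ := by
    intro htop
    refine hS ?_
    have hverts : ∀ v, v ∈ S.verts := by
      intro v
      have : e.symm v ∈ (S.comap e.toHom).verts := by rw [htop]; trivial
      simpa using this
    ext v w
    · simpa using hverts v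
    · rw [SimpleGraph.Subgraph.top_adj]
      refine ⟨fun hvw => S.adj_sub hvw, fun hvw => ?_⟩
      have h1 : (S.comap e.toHom).Adj (e.symm v) (e.symm w) := by
        rw [htop, SimpleGraph.Subgraph.top_adj]
        exact e.symm.map_adj_iff.2 hvw
      rw [SimpleGraph.Subgraph.comap_adj] at h1
      simpa using h1.2
  refine (h.2 _ hne).of_injective_hom
    (⟨fun v => ⟨e.symm v.1, ?_⟩, ?_⟩ : S.coe →g (S.comap e.toHom).coe) ?_
  · simp
  · intro v w hvw
    have h1 : S.Adj v.1 w.1 := hvw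
    show (S.comap e.toHom).Adj _ _
    rw [SimpleGraph.Subgraph.comap_adj]
    refine ⟨e.symm.map_adj_iff.2 (S.adj_sub h1), ?_⟩
    simpa using h1
  · intro v w hvw
    have h1 : e.symm v.1 = e.symm w.1 := congrArg Subtype.val hvw
    exact Subtype.ext (e.symm.injective h1)

/-- In a critical graph, a proper subset of minimum potential could be coloured and the
colouring extended, so only the whole vertex set has minimum potential;
by `exists_respectsOn` this minimum is less than `i - j`. -/
lemma IsCritical.potential_univ_le [Fintype V] (hi : 3 ≤ i) (hj : 2 * i + 1 ≤ j)
    (h : IsCritical G i j) : potential i j G (fullCapacity V i j) univ ≤ i - j - 1 := by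
  classical
  have hc : ∀ v, fullCapacity V i j v false ≤ i ∧ fullCapacity V i j v true ≤ j := by
    simp [fullCapacity]
  obtain ⟨hno, hsub⟩ := h
  rw [isColorable_iff] at hno
  push Not at hno
  obtain ⟨K, hK⟩ := hno
  rcases exists_minimizer_or i j G (fullCapacity V i j) univ with ⟨Q, -, hQ, hQne, hle⟩ | hmin
  · exfalso
    let G' : G.Subgraph := (⊤ : G.Subgraph).induce Q
    have hG' : G' ≠ ⊤ := by
      intro h
      have h1 : (Q : Set V) = Set.univ := congrArg SimpleGraph.Subgraph.verts h
      exact hQ (by exact_mod_cast h1)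
    have hcol := hsub G' hG'
    have : Fintype G'.verts := Fintype.ofFinite _
    rw [isColorable_iff] at hcol
    obtain ⟨φ', hφ'⟩ := hcol fun e => K (e.map Subtype.val)
    let φ₀ : V → Bool := fun v => if hv : v ∈ Q then φ' ⟨v, hv⟩ else false
    have hφ₀ : RespectsOn G K (fullCapacity V i j) Q φ₀ := by
      intro v hv
      have hv' : φ₀ v = φ' ⟨v, hv⟩ := by simp [φ₀, hv]
      rw [hv']
      refine le_trans ?_ (hφ' ⟨v, hv⟩ (mem_univ _))
      rw [← card_map (Function.Embedding.subtype _) (s := conflictsOn G'.coe _ φ' univ _)]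
      norm_cast
      refine card_le_card fun w hw => ?_
      rw [mem_conflictsOn] at hw
      obtain ⟨hwQ, hvw, hconf⟩ := hw
      rw [hv'] at hconf
      simp only [φ₀, hwQ, dite_true] at hconf
      refine mem_map.2 ⟨⟨w, hwQ⟩, ?_, rfl⟩
      rw [mem_conflictsOn]
      refine ⟨mem_univ _, ?_, hconf⟩
      show G'.Adj v w
      exact ⟨hv, hwQ, hvw⟩
    obtain ⟨φ, hφ⟩ := exists_respectsOn_union (by omega) hj hc
      (disjoint_sdiff (s := Q) (t := univ)) (fun T _ =>
        hle (Q ∪ T) (subset_univ _) (hQne.mono subset_union_left)) hφ₀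
    rw [union_sdiff_of_subset (subset_univ Q)] at hφ
    exact hK φ hφ
  · by_contra hlt
    push Not at hlt
    obtain ⟨φ, hφ⟩ := exists_respectsOn hi hj K hc (A := univ) (G := G) (fun S _ hS => by
      by_cases hSu : S = univ
      · rw [hSu]
        omega
      · have := hmin S (subset_univ S) hSu hS
        omega)
    exact hK φ hφ

/-- By `exists_respectsOn`, a graph that is not colourable is critical as soon as its whole vertex
set is the only nonempty one of potential less than `i - j`, and that by one. -/
lemma isCritical_of_potential [Fintype V] (hi : 3 ≤ i) (hj : 2 * i + 1 ≤ j) {K : Sym2 V → Bool}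
    (hno : ¬ ∃ φ, RespectsOn G K (fullCapacity V i j) univ φ)
    (huniv : potential i j G (fullCapacity V i j) univ = i - j - 1)
    (hsub : ∀ S, S ≠ univ → S.Nonempty → (i - j : ℤ) ≤ potential i j G (fullCapacity V i j) S) :
    IsCritical G i j := by
  classical
  refine ⟨fun h => hno ((isColorable_iff G).1 h K), fun G' hG' => ?_⟩
  have : Fintype G'.verts := Fintype.ofFinite _
  rw [isColorable_iff]
  intro K'
  refine exists_respectsOn hi hj K' (by simp [fullCapacity]) fun S _ hSne => ?_
  let T : Finset V := S.map (Function.Embedding.subtype _)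
  have himg : (edgesOn G'.coe S).map ⟨Sym2.map Subtype.val, Sym2.map.injective
      Subtype.val_injective⟩ ⊆ edgesOn G T := by
    intro e he
    obtain ⟨e', he', rfl⟩ := mem_map.1 he
    induction e' with
    | _ a b =>
      rw [mk_mem_edgesOn] at he'
      simp only [Function.Embedding.coeFn_mk, Sym2.map_mk, mk_mem_edgesOn, T]
      exact ⟨⟨mem_map_of_mem (Function.Embedding.subtype _) he'.1.1,
        mem_map_of_mem (Function.Embedding.subtype _) he'.1.2⟩, G'.adj_sub he'.2⟩
  have hcard : #T = #S := card_map _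
  have hle := card_le_card himg
  rw [card_map] at hle
  rw [potential_fullCapacity, ← hcard]
  by_cases hT : T = univ
  · have hverts : ∀ v, v ∈ G'.verts := by
      intro v
      have : v ∈ T := hT ▸ mem_univ v
      obtain ⟨w, -, rfl⟩ := mem_map.1 this
      exact w.2
    obtain ⟨u, v, huv, huv'⟩ : ∃ u v, G.Adj u v ∧ ¬ G'.Adj u v := by
      by_contra! hcon
      refine hG' ?_
      ext v w
      · simpa using hverts v
      · rw [SimpleGraph.Subgraph.top_adj]
        exact ⟨fun h => G'.adj_sub h, hcon v w⟩
    have hlt : #(edgesOn G'.coe S) < #(edgesOn G T) := by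
      rw [← card_map (⟨Sym2.map Subtype.val, Sym2.map.injective Subtype.val_injective⟩ :
        Sym2 G'.verts ↪ Sym2 V)]
      refine card_lt_card ⟨himg, fun hsup => ?_⟩
      have h1 : s(u, v) ∈ edgesOn G T := by
        rw [mk_mem_edgesOn, hT]
        exact ⟨⟨mem_univ _, mem_univ _⟩, huv⟩
      obtain ⟨e', he', heq⟩ := mem_map.1 (hsup h1)
      induction e' with
      | _ a b =>
        rw [mk_mem_edgesOn] at he'
        have h2 : G'.Adj a.1 b.1 := he'.2
        simp only [Function.Embedding.coeFn_mk, Sym2.map_mk, Sym2.eq_iff] at heq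
        rcases heq with ⟨h3, h4⟩ | ⟨h3, h4⟩
        · rw [h3, h4] at h2
          exact huv' h2
        · rw [h3, h4] at h2
          exact huv' h2.symm
    rw [hT] at hlt
    rw [potential_fullCapacity] at huniv
    rw [hT]
    have h1 : (#(edgesOn G'.coe S) : ℤ) + 1 ≤ #(edgesOn G univ) := by exact_mod_cast hlt
    have h2 : ((i : ℤ) + 1) * (#(edgesOn G'.coe S) + 1) ≤ (i + 1) * #(edgesOn G univ) :=
      mul_le_mul_of_nonneg_left h1 (by positivity)
    linarith
  · have h1 := hsub T hT (hSne.map)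
    rw [potential_fullCapacity] at h1
    have h2 : ((i : ℤ) + 1) * #(edgesOn G'.coe S) ≤ (i + 1) * #(edgesOn G T) :=
      mul_le_mul_of_nonneg_left (by exact_mod_cast hle) (by positivity)
    linarith

end Covers

/-! ### Tight weighted graphs -/

section Sharpness

/-- A weighted graph, with no colouring for the signs `K`, whose potential is only one less than the
bound that would guarantee colourings, while all its proper nonempty parts satisfy that bound. -/
structure IsTight {V : Type*} [Fintype V] (i j : ℕ) (G : SimpleGraph V) (K : Sym2 V → Bool)
    (c : V → Bool → ℤ) : Prop where
  not_respects : ¬ ∃ φ, RespectsOn G K c univ φ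
  potential_univ : potential i j G c univ = i - j - 1
  le_potential : ∀ S, S ≠ univ → S.Nonempty → (i - j : ℤ) ≤ potential i j G c S

variable {V : Type*} {i j s : ℕ} {G : SimpleGraph V} {K : Sym2 V → Bool} {c : V → Bool → ℤ}
  {v : V} {k : Bool}

/-- Attach a flag to `v`: a new neighbour `none` of `v` together with `s` new vertices adjacent
to both `v` and `none`. -/
def attach (G : SimpleGraph V) (v : V) (s : ℕ) : SimpleGraph (V ⊕ Option (Fin s)) where
  Adj
    | .inl a, .inl b => G.Adj a b
    | .inl a, .inr _ => a = v
    | .inr _, .inl a => a = v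
    | .inr none, .inr (some _) => True
    | .inr (some _), .inr none => True
    | .inr none, .inr none => False
    | .inr (some _), .inr (some _) => False
  symm := ⟨by rintro (a | _ | a) (b | _ | b) <;> simp [G.adj_comm]⟩
  loopless := ⟨by rintro (a | _ | a) <;> simp⟩

/-- The signs for which a flag at `v` produces a conflict at `v` whenever `v` has colour `k`. -/
def attachSign (K : Sym2 V → Bool) (k : Bool) (s : ℕ) : Sym2 (V ⊕ Option (Fin s)) → Bool :=
  Sym2.lift ⟨fun x y => match x, y with
    | .inl a, .inl b => K s(a, b)
    | .inl _, .inr _ => !k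
    | .inr _, .inl _ => !k
    | .inr _, .inr _ => false, by
    rintro (a | a) (b | b) <;> simp [Sym2.eq_swap]⟩

open Classical in
/-- The capacities after attaching a flag: the capacity of `v` for the colour `k` increases by
one, and the new neighbour of `v` cannot be poor if it conflicts with all `s` vertices of
degree two. -/
noncomputable def attachCapacity (i j : ℕ) (c : V → Bool → ℤ) (v : V) (k : Bool) (s : ℕ) :
    V ⊕ Option (Fin s) → Bool → ℤ
  | .inl w, b => c w b + if w = v ∧ b = k then 1 else 0
  | .inr none, b => if b then j else s - 1
  | .inr (some _), b => if b then j else i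

lemma card_edgesOn_map {V' : Type*} {G' : SimpleGraph V'} (f : V ↪ V')
    (h : ∀ a b, G'.Adj (f a) (f b) ↔ G.Adj a b) (S : Finset V) :
    #(edgesOn G' (S.map f)) = #(edgesOn G S) := by
  rw [← card_map (⟨Sym2.map f, Sym2.map.injective f.injective⟩ : Sym2 V ↪ Sym2 V')]
  congr 1
  ext e
  induction e with
  | _ x y =>
    rw [mk_mem_edgesOn]
    constructor
    · rintro ⟨⟨hx, hy⟩, hxy⟩
      obtain ⟨a, ha, rfl⟩ := mem_map.1 hx
      obtain ⟨b, hb, rfl⟩ := mem_map.1 hy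
      exact mem_map.2 ⟨s(a, b), mk_mem_edgesOn.2 ⟨⟨ha, hb⟩, (h a b).1 hxy⟩, rfl⟩
    · intro hxy
      obtain ⟨e, he, heq⟩ := mem_map.1 hxy
      induction e with
      | _ a b =>
        rw [mk_mem_edgesOn] at he
        simp only [Function.Embedding.coeFn_mk, Sym2.map_mk, Sym2.eq_iff] at heq
        rcases heq with ⟨rfl, rfl⟩ | ⟨rfl, rfl⟩
        · exact ⟨⟨mem_map_of_mem f he.1.1, mem_map_of_mem f he.1.2⟩, (h a b).2 he.2⟩
        · exact ⟨⟨mem_map_of_mem f he.1.2, mem_map_of_mem f he.1.1⟩, (h b a).2 he.2.symm⟩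

/-- The embedding of the vertices of degree two of a flag. -/
def attachLeaf (V : Type*) (s : ℕ) : Fin s ↪ V ⊕ Option (Fin s) :=
  Function.Embedding.some.trans Function.Embedding.inr

lemma potential_attach_leaves (Y : Finset (Fin s)) :
    potential i j (attach G v s) (attachCapacity i j c v k s) (Y.map (attachLeaf V s))
      = #Y * (2 * i + 1) := by
  have h1 : edgesOn (attach G v s) (Y.map (attachLeaf V s)) = ∅ := by
    rw [Finset.eq_empty_iff_forall_notMem]
    intro e he
    induction e with
    | _ x y =>
      rw [mk_mem_edgesOn] at he
      obtain ⟨⟨hx, hy⟩, hxy⟩ := he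
      obtain ⟨a, -, rfl⟩ := mem_map.1 hx
      obtain ⟨b, -, rfl⟩ := mem_map.1 hy
      exact hxy
  have h2 : ∀ y, vertexPotential i j (attachCapacity i j c v k s) (attachLeaf V s y)
      = 2 * i + 1 := by
    intro y
    simp only [vertexPotential, attachCapacity, attachLeaf, Function.Embedding.trans_apply,
      Function.Embedding.some_apply, Function.Embedding.inr_apply]
    simp
    ring
  simp only [potential, sum_map, h1, h2, sum_const, card_empty, nsmul_eq_mul]
  simp

variable [DecidableEq V]

lemma vertexPotential_attach_inl (w : V) :
    vertexPotential i j (attachCapacity i j c v k s) (.inl w)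
      = vertexPotential i j c w + if w = v then 1 else 0 := by
  simp only [vertexPotential, attachCapacity]
  by_cases hw : w = v <;> cases k <;> simp [hw] <;> ring

lemma potential_attach_inl (S : Finset V) :
    potential i j (attach G v s) (attachCapacity i j c v k s) (S.map Function.Embedding.inl)
      = potential i j G c S + if v ∈ S then 1 else 0 := by
  simp only [potential, sum_map, Function.Embedding.inl_apply, vertexPotential_attach_inl,
    sum_add_distrib, sum_ite_eq']
  rw [card_edgesOn_map (G := G) Function.Embedding.inl (fun a b => Iff.rfl)]
  ring

/-- The potential of a set that contains the part `S` of the old graph and `Y` of the vertices of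
degree two of the flag, but not the new neighbour of `v`. -/
lemma potential_attach_of_none_notMem (S : Finset V) (Y : Finset (Fin s)) :
    potential i j (attach G v s) (attachCapacity i j c v k s)
        (S.map Function.Embedding.inl ∪ Y.map (attachLeaf V s))
      = potential i j G c S + (if v ∈ S then 1 else 0)
        + #Y * (2 * i + 1 - (i + 1) * if v ∈ S then 1 else 0) := by
  have hdisj : Disjoint (S.map Function.Embedding.inl) (Y.map (attachLeaf V s)) := by
    rw [Finset.disjoint_left]
    intro x hx hx'
    obtain ⟨a, -, rfl⟩ := mem_map.1 hx
    obtain ⟨b, -, hb⟩ := mem_map.1 hx'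
    simp [attachLeaf] at hb
  have hn : ∀ y, (#(nbrsOn (attach G v s) (S.map Function.Embedding.inl) (attachLeaf V s y)) : ℤ)
      = if v ∈ S then 1 else 0 := by
    intro y
    have : nbrsOn (attach G v s) (S.map Function.Embedding.inl) (attachLeaf V s y)
        = ({w ∈ S | w = v} : Finset V).map Function.Embedding.inl := by
      ext x
      simp only [mem_nbrsOn, mem_map, mem_filter]
      constructor
      · rintro ⟨⟨a, ha, rfl⟩, h⟩
        exact ⟨a, ⟨ha, h⟩, rfl⟩
      · rintro ⟨a, ⟨ha, h⟩, rfl⟩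
        exact ⟨⟨a, ha, rfl⟩, h⟩
    rw [this, card_map, filter_eq']
    split_ifs <;> simp
  rw [potential_union hdisj, potential_attach_inl, potential_attach_leaves, sum_map]
  simp only [hn, sum_const, nsmul_eq_mul]
  ring

/-- The potential of a set that contains the part `S` of the old graph, `Y` of the vertices of
degree two of the flag, and the new neighbour of `v`. -/
lemma potential_attach_of_none_mem (S : Finset V) (Y : Finset (Fin s)) :
    potential i j (attach G v s) (attachCapacity i j c v k s)
        (insert (.inr none) (S.map Function.Embedding.inl) ∪ Y.map (attachLeaf V s))
      = potential i j G c S + (if v ∈ S then 1 else 0)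
        + (i + s - (i + 1) * if v ∈ S then 1 else 0)
        + #Y * (i - (i + 1) * if v ∈ S then 1 else 0) := by
  have hu : (.inr none : V ⊕ Option (Fin s)) ∉ S.map Function.Embedding.inl := by
    simp
  have hdisj : Disjoint (insert (.inr none) (S.map Function.Embedding.inl))
      (Y.map (attachLeaf V s)) := by
    rw [Finset.disjoint_left]
    intro x hx hx'
    obtain ⟨b, -, rfl⟩ := mem_map.1 hx'
    simp [attachLeaf] at hx
  have hn : ∀ x : Option (Fin s),
      (#(nbrsOn (attach G v s) (S.map Function.Embedding.inl) (.inr x)) : ℤ)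
        = if v ∈ S then 1 else 0 := by
    intro y
    have : nbrsOn (attach G v s) (S.map Function.Embedding.inl) (.inr y)
        = ({w ∈ S | w = v} : Finset V).map Function.Embedding.inl := by
      ext x
      simp only [mem_nbrsOn, mem_map, mem_filter]
      constructor
      · rintro ⟨⟨a, ha, rfl⟩, h⟩
        refine ⟨a, ⟨ha, ?_⟩, rfl⟩
        cases y <;> exact h
      · rintro ⟨a, ⟨ha, h⟩, rfl⟩
        refine ⟨⟨a, ha, rfl⟩, ?_⟩
        cases y <;> exact h
    rw [this, card_map, filter_eq']
    split_ifs <;> simp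
  have hn' : ∀ y, (#(nbrsOn (attach G v s) (insert (.inr none) (S.map Function.Embedding.inl))
      (attachLeaf V s y)) : ℤ) = (if v ∈ S then 1 else 0) + 1 := by
    intro y
    have : nbrsOn (attach G v s) (insert (.inr none) (S.map Function.Embedding.inl))
        (attachLeaf V s y) = insert (.inr none)
          (nbrsOn (attach G v s) (S.map Function.Embedding.inl) (attachLeaf V s y)) := by
      ext x
      simp only [mem_nbrsOn, mem_insert]
      constructor
      · rintro ⟨rfl | h, h'⟩
        · exact Or.inl rfl
        · exact Or.inr ⟨h, h'⟩
      · rintro (rfl | ⟨h, h'⟩)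
        · exact ⟨Or.inl rfl, trivial⟩
        · exact ⟨Or.inr h, h'⟩
    rw [this, card_insert_of_notMem (fun h => hu (mem_nbrsOn.1 h).1)]
    push_cast
    exact congrArg (· + 1) (hn (some y))
  have hv : vertexPotential i j (attachCapacity i j c v k s) (.inr none) = i + s := by
    simp [vertexPotential, attachCapacity]
    ring
  rw [potential_union hdisj, potential_insert hu, potential_attach_inl, potential_attach_leaves,
    sum_map, hn, hv]
  simp only [hn', sum_const, nsmul_eq_mul]
  ring

/-- Attaching a flag of any size `s` preserves tightness. -/
lemma IsTight.attach [Fintype V] (hj : i ≤ j) (h : IsTight i j G K c) (v : V) (k : Bool) (s : ℕ) :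
    IsTight i j (attach G v s) (attachSign K k s) (attachCapacity i j c v k s) := by
  have hi : (0 : ℤ) ≤ i := by positivity
  have hij : (i : ℤ) ≤ j := by exact_mod_cast hj
  have hcases : ∀ T : Finset (V ⊕ Option (Fin s)), ∃ (S : Finset V) (Y : Finset (Fin s)),
      T = S.map Function.Embedding.inl ∪ Y.map (attachLeaf V s) ∨
      T = insert (.inr none) (S.map Function.Embedding.inl) ∪ Y.map (attachLeaf V s) := by
    intro T
    refine ⟨univ.filter fun a => .inl a ∈ T, univ.filter fun l => .inr (some l) ∈ T, ?_⟩
    by_cases hn : (.inr none : V ⊕ Option (Fin s)) ∈ T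
    · right
      ext (a | _ | l) <;> simp [attachLeaf, hn]
    · left
      ext (a | _ | l) <;> simp [attachLeaf, hn]
  have hpos : ∀ S : Finset V, S ≠ univ → (i - j : ℤ) ≤ potential i j G c S := by
    intro S hS
    rcases S.eq_empty_or_nonempty with rfl | hne
    · rw [potential_empty]
      linarith
    · exact h.le_potential S hS hne
  refine ⟨?_, ?_, ?_⟩
  · rintro ⟨φ, hφ⟩
    refine h.not_respects ⟨fun w => φ (.inl w), fun w _ => ?_⟩
    have h1 := hφ (.inl w) (mem_univ _)
    have hmap : (conflictsOn G K (fun w => φ (.inl w)) univ w).map Function.Embedding.inl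
        ⊆ conflictsOn (DefectiveDP.attach G v s) (attachSign K k s) φ univ (.inl w) := by
      intro x hx
      obtain ⟨a, ha, rfl⟩ := mem_map.1 hx
      rw [mem_conflictsOn] at ha ⊢
      exact ⟨mem_univ _, ha.2.1, ha.2.2⟩
    have hle := card_le_card hmap
    rw [card_map] at hle
    by_cases hw : w = v ∧ φ (.inl w) = k
    · obtain ⟨rfl, hk⟩ := hw
      -- the flag contributes a conflict at its base
      obtain ⟨x, hx⟩ : ∃ x : Option (Fin s), (.inr x) ∈
          conflictsOn (DefectiveDP.attach G w s) (attachSign K k s) φ univ (.inl w) := by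
        have hbase : ∀ x : Option (Fin s), φ (.inr x) = true → (.inr x) ∈
            conflictsOn (DefectiveDP.attach G w s) (attachSign K k s) φ univ (.inl w) := by
          intro x hx
          rw [mem_conflictsOn]
          refine ⟨mem_univ _, ?_, ?_⟩
          · cases x <;> exact rfl
          · rw [hx, hk]
            cases k <;> rfl
        by_contra hcon
        push Not at hcon
        have hfalse : ∀ x : Option (Fin s), φ (.inr x) = false := fun x => by
          by_contra hx
          exact hcon x (hbase x (by simpa using hx))
        have h2 := hφ (.inr none) (mem_univ _)
        have h3 : (univ : Finset (Fin s)).map (attachLeaf V s) ⊆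
            conflictsOn (DefectiveDP.attach G w s) (attachSign K k s) φ univ (.inr none) := by
          intro x hx
          obtain ⟨l, -, rfl⟩ := mem_map.1 hx
          rw [mem_conflictsOn]
          refine ⟨mem_univ _, trivial, ?_⟩
          have : φ (attachLeaf V s l) = false := hfalse (some l)
          rw [this, hfalse]
          rfl
        have h4 := card_le_card h3
        rw [card_map, card_univ, Fintype.card_fin] at h4
        rw [hfalse] at h2
        simp only [attachCapacity, Bool.false_eq_true, if_false] at h2
        omega
      have hins : insert (.inr x)
          ((conflictsOn G K (fun w => φ (.inl w)) univ w).map Function.Embedding.inl)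
          ⊆ conflictsOn (DefectiveDP.attach G w s) (attachSign K k s) φ univ (.inl w) :=
        insert_subset hx hmap
      have h5 := card_le_card hins
      rw [card_insert_of_notMem (by simp), card_map] at h5
      simp only [attachCapacity, hk, and_self, if_true] at h1
      beta_reduce
      rw [hk]
      omega
    · simp only [attachCapacity, hw, if_false] at h1
      beta_reduce
      omega
  · have h1 : (univ : Finset (V ⊕ Option (Fin s)))
        = insert (.inr none) (univ.map Function.Embedding.inl) ∪ univ.map (attachLeaf V s) := by
      ext (a | _ | l) <;> simp [attachLeaf]
    rw [h1, potential_attach_of_none_mem, h.potential_univ, card_univ, Fintype.card_fin]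
    simp
    ring
  · intro T hT hTne
    obtain ⟨S, Y, rfl | rfl⟩ := hcases T
    · rw [potential_attach_of_none_notMem]
      have hY : (0 : ℤ) ≤ #Y * i := by positivity
      have hY' : (0 : ℤ) ≤ #Y := by positivity
      by_cases hS : S = univ
      · subst hS
        rw [h.potential_univ]
        simp only [mem_univ, if_true]
        linarith
      · have := hpos S hS
        split_ifs <;> linarith
    · rw [potential_attach_of_none_mem]
      have hY : (0 : ℤ) ≤ #Y * i := by positivity
      have hY2 : #Y ≤ s := by simpa using card_le_univ Y
      have hY' : (#Y : ℤ) ≤ s := by exact_mod_cast hY2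
      by_cases hS : S = univ
      · subst hS
        rw [h.potential_univ]
        have hY3 : #Y ≠ s := by
          intro h0
          refine hT ?_
          have : Y = univ := by
            rw [← card_eq_iff_eq_univ, h0, Fintype.card_fin]
          subst this
          ext (a | _ | l) <;> simp [attachLeaf]
        have hY4 : (#Y : ℤ) + 1 ≤ s := by exact_mod_cast lt_of_le_of_ne hY2 hY3
        simp only [mem_univ, if_true]
        linarith
      · have := hpos S hS
        have hs : (0 : ℤ) ≤ s := by positivity
        split_ifs <;> linarith

end Sharpness

/-! ### Arbitrarily large critical graphs -/

section Family

variable {i j : ℕ}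

open Classical in
/-- Full capacities, except for the vertex `v`, which has capacities `a` (poor) and `b` (rich). -/
noncomputable def capacityAt {V : Type*} (i j : ℕ) (v : V) (a b : ℤ) : V → Bool → ℤ :=
  fun w x => if w = v then (if x then b else a) else (if x then j else i)

lemma exists_isTight_single (i j : ℕ) :
    ∃ (K : Sym2 Unit → Bool), IsTight i j (⊥ : SimpleGraph Unit) K (capacityAt i j () (-1) (-1)) := by
  refine ⟨fun _ => true, ?_, ?_, ?_⟩
  · rintro ⟨φ, hφ⟩
    have := hφ () (mem_univ _)
    simp only [capacityAt, if_true, ite_self] at this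
    omega
  · have h1 : edgesOn (⊥ : SimpleGraph Unit) univ = ∅ := by
      ext e
      simp [mem_edgesOn]
    rw [potential, h1]
    simp [vertexPotential, capacityAt]
    ring
  · intro S hS hne
    exact absurd (Finset.eq_univ_of_card S (by
      have h1 := card_pos.2 hne
      have h2 := card_le_univ S
      simp at h2 ⊢
      omega)) hS

/-- There is a tight graph on at least `n` vertices with the capacities `capacityAt i j v a b`. -/
def ExistsTight (i j n : ℕ) (a b : ℤ) : Prop :=
  ∃ (V : Type) (_ : Fintype V) (G : SimpleGraph V) (K : Sym2 V → Bool) (v : V),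
    n ≤ Fintype.card V ∧ IsTight i j G K (capacityAt i j v a b)

lemma ExistsTight.poor_succ (hj : i ≤ j) {n : ℕ} {a b : ℤ} (h : ExistsTight i j n a b) :
    ExistsTight i j n (a + 1) b := by
  classical
  obtain ⟨V, _, G, K, v, hn, hT⟩ := h
  refine ⟨V ⊕ Option (Fin (i + 1)), inferInstance, _, _, .inl v, ?_,
    (?_ : attachCapacity i j (capacityAt i j v a b) v false (i + 1) = _) ▸
      hT.attach hj v false (i + 1)⟩
  · simp
    omega
  · funext x y
    rcases x with w | _ | l <;> cases y <;> simp [attachCapacity, capacityAt]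
    by_cases hw : w = v <;> simp [hw]

lemma ExistsTight.rich_succ (hj : i ≤ j) {n : ℕ} {a b : ℤ} (h : ExistsTight i j n a b) :
    ExistsTight i j n a (b + 1) := by
  classical
  obtain ⟨V, _, G, K, v, hn, hT⟩ := h
  refine ⟨V ⊕ Option (Fin (i + 1)), inferInstance, _, _, .inl v, ?_,
    (?_ : attachCapacity i j (capacityAt i j v a b) v true (i + 1) = _) ▸
      hT.attach hj v true (i + 1)⟩
  · simp
    omega
  · funext x y
    rcases x with w | _ | l <;> cases y <;> simp [attachCapacity, capacityAt]
    by_cases hw : w = v <;> simp [hw]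

/-- A flag with only `i` vertices of degree two moves the missing unit of poor capacity from `v`
to the new neighbour of `v`. -/
lemma ExistsTight.move (hj : i ≤ j) {n : ℕ} (h : ExistsTight i j n (i - 1) j) :
    ExistsTight i j (n + 1) (i - 1) j := by
  classical
  obtain ⟨V, _, G, K, v, hn, hT⟩ := h
  refine ⟨V ⊕ Option (Fin i), inferInstance, _, _, .inr none, ?_,
    (?_ : attachCapacity i j (capacityAt i j v (i - 1) j) v false i = _) ▸
      hT.attach hj v false i⟩
  · simp
    omega
  · funext x y
    rcases x with w | _ | l <;> cases y <;> simp [attachCapacity, capacityAt]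
    by_cases hw : w = v <;> simp [hw]

lemma existsTight_full (hj : i ≤ j) (n : ℕ) : ExistsTight i j n i j := by
  have h0 : ExistsTight i j 0 (-1) (-1) := by
    obtain ⟨K, hK⟩ := exists_isTight_single i j
    exact ⟨Unit, inferInstance, _, K, (), Nat.zero_le _, hK⟩
  have h1 : ∀ b : ℕ, ExistsTight i j 0 (-1) (b - 1) := by
    intro b
    induction b with
    | zero => simpa using h0
    | succ b ih =>
      have := ih.rich_succ hj
      push_cast
      rwa [show (b : ℤ) - 1 + 1 = b + 1 - 1 by ring] at this
  have h2 : ∀ a : ℕ, ExistsTight i j 0 (a - 1) j := by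
    intro a
    induction a with
    | zero => simpa using h1 (j + 1)
    | succ a ih =>
      have := ih.poor_succ hj
      push_cast
      rwa [show (a : ℤ) - 1 + 1 = a + 1 - 1 by ring] at this
  have h3 : ∀ n : ℕ, ExistsTight i j n (i - 1) j := by
    intro n
    induction n with
    | zero => exact h2 i
    | succ n ih => exact ih.move hj
  simpa using (h3 n).poor_succ hj

lemma exists_isCritical (hi : 3 ≤ i) (hj : 2 * i + 1 ≤ j) (n : ℕ) :
    ∃ m ≥ n, ∃ G : SimpleGraph (Fin m), IsCritical G i j ∧
      edgeBound i j m = (G.edgeSet.ncard : ℝ) := by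
  obtain ⟨V, _, G, K, v, hn, hT⟩ := existsTight_full (by omega : i ≤ j) n
  have hcap : capacityAt i j v i j = fullCapacity V i j := by
    funext w x
    simp [capacityAt, fullCapacity]
  rw [hcap] at hT
  refine ⟨Fintype.card V, hn, G.overFin rfl,
    (isCritical_of_potential hi hj hT.not_respects hT.potential_univ hT.le_potential).of_iso
      (G.overFinIso rfl), ?_⟩
  have h1 : (G.overFin rfl).edgeSet.ncard = G.edgeSet.ncard := by
    rw [← Nat.card_coe_set_eq, ← Nat.card_coe_set_eq]
    exact Nat.card_congr (G.overFinIso rfl).mapEdgeSet.symm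
  have h2 := hT.potential_univ
  rw [potential_fullCapacity, card_edgesOn_univ, card_univ] at h2
  rw [h1, edgeBound, div_eq_iff (by positivity)]
  have h3 : ((2 * i + 1) * Fintype.card V - (i + 1) * G.edgeSet.ncard : ℝ) = i - j - 1 := by
    exact_mod_cast h2
  linarith

end Family

/-! ### The bound on the number of edges -/

section Bound

lemma toEReal_natCast (n : ℕ) : (((n : ℕ∞) : ENNReal) : EReal) = ((n : ℝ) : EReal) := by
  rw [ENat.toENNReal_coe, ← ENNReal.ofReal_natCast, EReal.coe_ennreal_ofReal,
    max_eq_left (Nat.cast_nonneg n)]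

lemma edgeBound_le_of_isCritical {i j : ℕ} (hi : 3 ≤ i) (hj : 2 * i + 1 ≤ j) {V : Type u}
    [Fintype V] {G : SimpleGraph V} (h : IsCritical G i j) :
    edgeBound i j (Fintype.card V) ≤ (G.edgeSet.ncard : ℝ) := by
  have h1 := h.potential_univ_le hi hj
  rw [potential_fullCapacity, card_edgesOn_univ, card_univ] at h1
  have h2 : ((2 * i + 1) * Fintype.card V - (i + 1) * G.edgeSet.ncard : ℝ) ≤ i - j - 1 := by
    exact_mod_cast h1
  rw [edgeBound, div_le_iff₀ (by positivity)]
  linarith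

end Bound

end DefectiveDP

open DefectiveDP in
theorem theorem1 (i j : ℕ) (hi : 3 ≤ i) (hj : 2 * i + 1 ≤ j) :
    (∀ (V : Type u) [Fintype V] (G : SimpleGraph V), DefectiveDP.IsCritical G i j →
      DefectiveDP.edgeBound i j (Fintype.card V) ≤ (G.edgeSet.ncard : ℝ)) ∧
    (∀ n : ℕ, (DefectiveDP.edgeBound i j n : EReal) ≤ ((DefectiveDP.gDP i j n : ENNReal) : EReal)) ∧
    {n : ℕ | ((DefectiveDP.gDP i j n : ENNReal) : EReal) =
      (DefectiveDP.edgeBound i j n : EReal)}.Infinite := by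
  have hfin : ∀ (n : ℕ) (G : SimpleGraph (Fin n)), IsCritical G i j →
      edgeBound i j n ≤ (G.edgeSet.ncard : ℝ) := by
    intro n G hG
    simpa using edgeBound_le_of_isCritical hi hj hG
  refine ⟨fun V _ G hG => edgeBound_le_of_isCritical hi hj hG, fun n => ?_, ?_⟩
  · have h1 : ((⌈edgeBound i j n⌉₊ : ℕ) : ℕ∞) ≤ gDP i j n :=
      le_iInf₂ fun G hG => by exact_mod_cast Nat.ceil_le.2 (hfin n G hG)
    have h2 : (((⌈edgeBound i j n⌉₊ : ℕ) : ℕ∞) : ENNReal) ≤ (gDP i j n : ENNReal) :=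
      ENat.toENNReal_le.2 h1
    refine le_trans ?_ (EReal.coe_ennreal_le_coe_ennreal_iff.2 h2)
    rw [toEReal_natCast]
    exact EReal.coe_le_coe_iff.2 (Nat.le_ceil _)
  · refine Set.infinite_of_forall_exists_gt fun n => ?_
    obtain ⟨m, hm, G, hG, he⟩ := exists_isCritical hi hj (n + 1)
    refine ⟨m, ?_, hm⟩
    have h1 : gDP i j m = (G.edgeSet.ncard : ℕ∞) := by
      refine le_antisymm (iInf₂_le G hG) (le_iInf₂ fun G' hG' => ?_)
      have := hfin m G' hG'
      rw [he] at this
      exact_mod_cast this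
    rw [Set.mem_ofPred_eq, h1, he, toEReal_natCast]
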